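/- For $a\in\mathbb R$ write $\langle a\rangle=(1+a^2)^{1/2}$, and let $\widetilde u(\tau,\xi)$ denote the space-time Fourier transform of a tempered distribution $u$ on $\mathbb R^{1+1}=\mathbb R_t\times\mathbb R_x$. For $s,b\in\mathbb R$ and a choice of sign $\pm$ put $$\|u\|_{Z^{s,b}_\pm}=\big\|\langle\tau\mp\xi\rangle^s\langle\tau\pm\xi\rangle^b\,\widetilde u(\tau,\xi)\big\|_{L^2_{\tau,\xi}},\qquad \|u\|_{Y^{s,b}_\pm}=\big\|\langle\xi\rangle^s\langle\tau\pm\xi\rangle^b\,\widetilde u(\tau,\xi)\big\|_{L^2_\xi L^1_\tau},$$ where the norms are $+\infty$ if $\widetilde u$ is not a function. Let $-\frac12<s\le 0$, $0<\epsilon<\frac12$ and $\frac12<b<\min\{1+s,1-\epsilon\}$. Let $\rho,\sigma\in C_0^\infty(\mathbb R)$ satisfy $\rho(t)=1$ for $t\in[-1,1]$, $\sigma(t)=1$ for $t\in\operatorname{supp}\rho$, and $\operatorname{supp}\rho\subset\operatorname{supp}\sigma\subset[-2,2]$. For $0<T<1$ set $\rho_T(t)=\rho(t/T)$ and $\sigma_T(t)=\sigma(t/T)$.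 Then, for either choice of sign, there is a constant $C$, depending on $s,b,\epsilon,\rho,\sigma$ but not on $T$, $\psi$ or $F$, such that for all $0<T<1$ and all tempered distributions $\psi,F$ on $\mathbb R^{1+1}$ with $$\partial_t\psi\pm\partial_x\psi=F$$ in the sense of distributions, one has $$\|\rho_T(t)\,\psi\|_{Z^{s,b}_\pm}\le C\Big(T^{\frac12-b}\,\|\sigma_T(t)\,\psi\|_{Y^{s,0}_\pm}+T^{\epsilon}\,\|F\|_{Z^{s,b-1+\epsilon}_\pm}\Big).$$ -/

import Mathlib

open MeasureTheory
open scoped ENNReal NNReal ContDiff SchwartzMap FourierTransform LineDeriv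

noncomputable section

namespace NullEnergy

/-- Space-time `ℝ^{1+1}` with the Euclidean inner product; the first coordinate is the time `t`
(dual variable `τ`), the second one is the space variable `x` (dual variable `ξ`). -/
abbrev Spacetime : Type := WithLp 2 (ℝ × ℝ)

/-- The point `(t, x)`. -/
def pt (t x : ℝ) : Spacetime := WithLp.toLp 2 (t, x)

/-- The Japanese bracket `⟨a⟩ = (1 + a²)^{1/2}`. -/
def bracket (a : ℝ) : ℝ := Real.sqrt (1 + a ^ 2)

/-- The space-time Fourier transform of the tempered distribution `u` is (integration against) the
function `g(τ, ξ)`. -/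
def HasFourierDensity (u : 𝓢'(Spacetime, ℂ)) (g : ℝ × ℝ → ℂ) : Prop :=
  AEStronglyMeasurable g volume ∧
    ∀ φ : 𝓢(Spacetime, ℂ),
      Integrable (fun p : ℝ × ℝ => φ (pt p.1 p.2) * g p) volume ∧
        (𝓕 u) φ = ∫ p : ℝ × ℝ, φ (pt p.1 p.2) * g p

/-- The norm `‖⟨τ ∓ ξ⟩^s ⟨τ ± ξ⟩^b ũ(τ, ξ)‖_{L²_{τ,ξ}}` of `Z^{s,b}_±`, where `κ = ±1` is the sign.
The density `ũ` is unique up to null sets, so the infimum is over at most one value;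
the norm is `∞` if the Fourier transform of `u` is not a function. -/
def ZNorm (κ s b : ℝ) (u : 𝓢'(Spacetime, ℂ)) : ℝ≥0∞ :=
  ⨅ (g : ℝ × ℝ → ℂ) (_ : HasFourierDensity u g),
    (∫⁻ p : ℝ × ℝ,
      (ENNReal.ofReal (bracket (p.1 - κ * p.2) ^ s * bracket (p.1 + κ * p.2) ^ b) *
        ‖g p‖ₑ) ^ (2 : ℝ)) ^ (1 / 2 : ℝ)

/-- The norm `‖⟨ξ⟩^s ⟨τ ± ξ⟩^b ũ(τ, ξ)‖_{L²_ξ L¹_τ}` of `Y^{s,b}_±`, where `κ = ±1` is the sign,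
with the same conventions as for `ZNorm`. -/
def YNorm (κ s b : ℝ) (u : 𝓢'(Spacetime, ℂ)) : ℝ≥0∞ :=
  ⨅ (g : ℝ × ℝ → ℂ) (_ : HasFourierDensity u g),
    (∫⁻ ξ : ℝ,
      (∫⁻ τ : ℝ,
        ENNReal.ofReal (bracket ξ ^ s * bracket (τ + κ * ξ) ^ b) * ‖g (τ, ξ)‖ₑ) ^ (2 : ℝ))
      ^ (1 / 2 : ℝ)

/-- The function `(t, x) ↦ η(t / T)` on space-time. -/
def timeCutoff (η : ℝ → ℂ) (T : ℝ) : Spacetime → ℂ := fun p => η (p.fst / T)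

/-- For a test function `η` the cutoff has temperate growth, so that multiplication by it
is the usual multiplication of a tempered distribution by a smooth function. -/
theorem timeCutoff_hasTemperateGrowth {η : ℝ → ℂ} (hη : ContDiff ℝ ∞ η)
    (hη' : HasCompactSupport η) (T : ℝ) : (timeCutoff η T).HasTemperateGrowth := by
  have h1 : η.HasTemperateGrowth := hη'.hasTemperateGrowth hη
  have h2 := (T⁻¹ • WithLp.fstL 2 ℝ ℝ ℝ : Spacetime →L[ℝ] ℝ).hasTemperateGrowth
  have h3 := h1.comp h2
  have h4 : timeCutoff η T = η ∘ (T⁻¹ • WithLp.fstL 2 ℝ ℝ ℝ : Spacetime →L[ℝ] ℝ) := by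
    ext p
    simp [timeCutoff, div_eq_inv_mul]
  rw [h4]
  exact h3

/-- The product `η(t / T) u` for a tempered distribution `u` on space-time. -/
def cutoffMul (η : ℝ → ℂ) (T : ℝ) (u : 𝓢'(Spacetime, ℂ)) : 𝓢'(Spacetime, ℂ) :=
  TemperedDistribution.smulLeftCLM ℂ (timeCutoff η T) u

/-- `∂_t ψ ± ∂_x ψ = F` in the sense of distributions, where `κ = ±1` is the sign. -/
def SolvesTransport (κ : ℝ) (ψ F : 𝓢'(Spacetime, ℂ)) : Prop :=
  ∂_{pt 1 0} ψ + κ • ∂_{pt 0 1} ψ = F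

end NullEnergy

end

namespace NullEnergy

/-! Write `h`, `g`, `f` for the Fourier densities of `ρ_T ψ`, `σ_T ψ`, `F`, and let `ℓ = τ + κξ`, `D
= ⟨τ - κξ⟩`. Since `σ = 1` on the support of `ρ`, `h` is the convolution in `τ` of `g` with the
Fourier transform of `ρ_T`. Moreover `ρ_T ψ` solves the transport equation with source `T⁻¹ (ρ')_T ψ
+ ρ_T F`. The transforms of `ρ_T` and `(ρ')_T` are dominated by `T (1 + T|ν|)⁻⁴`, so with `K` the
corresponding positive operator (`kernOp 4`) one has `h ≲ K g` and `|ℓ| h ≲ T⁻¹ K g + K f`. From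
here only these two pointwise bounds matter (`exists_weighted_norm_le`).

The first bound is used for `T|ℓ| ≤ 1`, the second for `T|ℓ| > 1`. In both regions the weight on `K
g` is at most `T^(-b) ⟨ξ⟩^s V^(-s)` with `V = 1 + 1/(T D)`. The weight on `K f` is moderate at scale
`1/T` up to the same loss `V^(-s)`, and dividing by `|ℓ| > 1/T` gains `T^ε`
(`weight_le_mul_weight`).

The loss is harmless: `V^(-2s)` is integrable against the kernel uniformly in `T`, because `-2s < 1`
(`exists_lintegral_loss_kern_le`). Hence `V^(-s) K` maps `L¹_τ` to `L²_τ` with norm `O(T^(1/2))`,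
giving `T^(1/2 - b)`. By Schur's test the corresponding operator with the kernel `T (1 + T|ν|)⁻²` is
bounded on `L²`, giving `T^ε`. -/

theorem bracket_pos (a : ℝ) : 0 < bracket a := Real.sqrt_pos.2 (by positivity)

theorem one_le_bracket (a : ℝ) : 1 ≤ bracket a :=
  Real.one_le_sqrt.2 (by nlinarith [sq_nonneg a])

theorem abs_le_bracket (a : ℝ) : |a| ≤ bracket a :=
  Real.abs_le_sqrt (by linarith)

theorem bracket_le (a : ℝ) : bracket a ≤ 1 + |a| := by
  refine Real.sqrt_le_iff.2 ⟨by positivity, ?_⟩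
  nlinarith [abs_nonneg a, sq_abs a]

theorem bracket_le_add (a c : ℝ) : bracket a ≤ bracket c + |c - a| := by
  have h1 : bracket c ^ 2 = 1 + c ^ 2 := Real.sq_sqrt (by positivity)
  have h2 := abs_le_bracket c
  refine Real.sqrt_le_iff.2 ⟨by have := bracket_pos c; positivity, ?_⟩
  have h3 : c * (a - c) ≤ bracket c * |c - a| := by
    calc c * (a - c) ≤ |c * (a - c)| := le_abs_self _
      _ = |c| * |c - a| := by rw [abs_mul, abs_sub_comm]
      _ ≤ _ := by gcongr
  nlinarith [sq_abs (c - a)]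

@[fun_prop]
theorem continuous_bracket : Continuous bracket := by
  unfold bracket; fun_prop

@[fun_prop]
theorem measurable_bracket : Measurable bracket := continuous_bracket.measurable

/-! ### Kernels at scale `T` and the integrable loss -/

theorem lintegral_comp_mul_sub {T : ℝ} (hT : 0 < T) (c : ℝ) {G : ℝ → ℝ≥0∞} (hG : Measurable G) :
    ∫⁻ x, ENNReal.ofReal T * G (T * (x - c)) = ∫⁻ x, G x := by
  rw [lintegral_sub_right_eq_self (fun x => ENNReal.ofReal T * G (T * x)) c]
  conv_rhs => rw [← Real.smul_map_volume_mul_left hT.ne']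
  rw [lintegral_smul_measure, lintegral_map hG (by fun_prop), abs_of_pos hT, smul_eq_mul,
    lintegral_const_mul _ (by fun_prop)]

/-- The kernel `T (1 + T|ν|)⁻ⁿ`, an upper bound for the Fourier transform of a cutoff at scale `T`. -/
noncomputable def kern (n : ℕ) (T ν : ℝ) : ℝ := T * ((1 + T * |ν|) ^ n)⁻¹

theorem kern_nonneg (n : ℕ) {T : ℝ} (hT : 0 < T) (ν : ℝ) : 0 ≤ kern n T ν := by
  unfold kern; positivity

@[fun_prop]
theorem measurable_kern (n : ℕ) (T : ℝ) : Measurable (kern n T) := by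
  unfold kern; fun_prop

/-- The quantity `1 + 1 / (T d)`. -/
noncomputable def loss (T d : ℝ) : ℝ := 1 + (T * d)⁻¹

theorem one_le_loss {T d : ℝ} (hT : 0 < T) (hd : 0 < d) : 1 ≤ loss T d := by
  have : 0 ≤ (T * d)⁻¹ := by positivity
  unfold loss; linarith

@[fun_prop]
theorem measurable_loss (T : ℝ) : Measurable (loss T) := by
  unfold loss; fun_prop

/-- The singular weight `(1 + 1 / (T⟨x - c⟩))^q`, `q < 1`, is integrable against the kernel of
scale `T`, uniformly in all parameters. -/
theorem exists_lintegral_loss_kern_le {q : ℝ} (hq0 : 0 ≤ q) (hq : q < 1) :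
    ∃ C : ℝ≥0, ∀ T : ℝ, 0 < T → ∀ c m : ℝ,
      ∫⁻ x, ENNReal.ofReal (loss T (bracket (x - c)) ^ q) * ENNReal.ofReal (kern 2 T (x - m))
        ≤ C := by
  -- The one-sided singularity `x^(-q)` is integrable at 0 because `q < 1`; the sum `f y + f (-y)`
  -- below makes it symmetric.
  let f : ℝ → ℝ≥0∞ := (Set.Ioc 0 1).indicator fun x => ENNReal.ofReal (x ^ (-q))
  have hf : Measurable f := by
    refine Measurable.indicator (by fun_prop) measurableSet_Ioc
  have hfi : ∫⁻ x, f x < ⊤ := by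
    rw [lintegral_indicator measurableSet_Ioc]
    have h := (intervalIntegral.intervalIntegrable_rpow' (a := 0) (b := 1)
      (show -1 < -q by linarith)).1
    refine lt_of_le_of_lt (lintegral_mono fun x => ?_) h.2
    exact Real.ofReal_le_enorm _
  let p : ℝ → ℝ≥0∞ := fun x => ENNReal.ofReal (((1 + |x|) ^ 2)⁻¹)
  have hp : Measurable p := by fun_prop
  have hpi : ∫⁻ x, p x < ⊤ := by
    refine lt_of_eq_of_lt (lintegral_congr fun x => ?_)
      (finite_integral_one_add_norm (E := ℝ) (μ := volume) (r := 2) (by simp))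
    simp only [p]
    rw [Real.rpow_neg (by positivity), Real.rpow_ofNat, Real.norm_eq_abs]
  -- To be used with `y = T (x - c)` and `d = T⟨x - c⟩`: the loss is at most `|y|^(-q)` near 0 and
  -- bounded elsewhere. Against the kernel, the singular part only needs the kernel to be at most
  -- `T`; the bounded part needs its integral.
  have hpt : ∀ y d : ℝ, y ≠ 0 → |y| ≤ d →
      ENNReal.ofReal ((1 + d⁻¹) ^ q) ≤ 2 * (f y + f (-y) + 1) := by
    intro y d hy hd
    have hy' : 0 < |y| := abs_pos.2 hy
    have hd' : 0 < d := hy'.trans_le hd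
    have h2q : (2 : ℝ) ^ q ≤ 2 := by
      simpa using Real.rpow_le_rpow_of_exponent_le one_le_two hq.le
    rcases le_total d 1 with h1 | h1
    · have h3 : f |y| ≤ f y + f (-y) := by
        rcases le_total 0 y with h | h
        · rw [abs_of_nonneg h]; exact le_self_add
        · rw [abs_of_nonpos h]; exact le_add_self
      have h4 : f |y| = ENNReal.ofReal (|y| ^ (-q)) :=
        Set.indicator_of_mem (show |y| ∈ Set.Ioc 0 1 from ⟨hy', hd.trans h1⟩) _
      have h5 : (1 + d⁻¹) ^ q ≤ 2 * |y| ^ (-q) := by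
        have hdi : 1 ≤ d⁻¹ := (one_le_inv₀ hd').2 h1
        calc (1 + d⁻¹) ^ q ≤ (2 * |y|⁻¹) ^ q := by
              refine Real.rpow_le_rpow (by positivity) ?_ hq0
              have : d⁻¹ ≤ |y|⁻¹ := inv_anti₀ hy' hd
              linarith
          _ = 2 ^ q * |y| ^ (-q) := by
              rw [Real.mul_rpow (by positivity) (by positivity), Real.inv_rpow (by positivity),
                Real.rpow_neg (by positivity)]
          _ ≤ _ := by gcongr
      calc ENNReal.ofReal ((1 + d⁻¹) ^ q) ≤ ENNReal.ofReal (2 * |y| ^ (-q)) :=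
            ENNReal.ofReal_le_ofReal h5
        _ = 2 * f |y| := by rw [h4, ENNReal.ofReal_mul zero_le_two]; simp
        _ ≤ _ := by gcongr; exact h3.trans le_self_add
    · have h5 : (1 + d⁻¹) ^ q ≤ 2 := by
        refine (Real.rpow_le_rpow (by positivity) ?_ hq0).trans h2q
        have : d⁻¹ ≤ 1 := inv_le_one_of_one_le₀ h1
        linarith
      calc ENNReal.ofReal ((1 + d⁻¹) ^ q) ≤ ENNReal.ofReal 2 := ENNReal.ofReal_le_ofReal h5
        _ = 2 * 1 := by simp
        _ ≤ _ := by gcongr; exact le_add_self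
  have hne : (2 * ((∫⁻ x, f x) + (∫⁻ x, f x) + ∫⁻ x, p x)) ≠ ⊤ := by
    simp [ENNReal.mul_eq_top, hfi.ne, hpi.ne]
  refine ⟨(2 * ((∫⁻ x, f x) + (∫⁻ x, f x) + ∫⁻ x, p x)).toNNReal, fun T hT c m => ?_⟩
  rw [ENNReal.coe_toNNReal hne]
  have hk : ∀ x, ENNReal.ofReal (kern 2 T (x - m)) = ENNReal.ofReal T * p (T * (x - m)) := by
    intro x
    simp only [kern, p, abs_mul, abs_of_pos hT]
    rw [ENNReal.ofReal_mul hT.le]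
  calc ∫⁻ x, ENNReal.ofReal (loss T (bracket (x - c)) ^ q) * ENNReal.ofReal (kern 2 T (x - m))
      ≤ ∫⁻ x, 2 * (ENNReal.ofReal T * f (T * (x - c)) + ENNReal.ofReal T * f (-(T * (x - c)))
          + ENNReal.ofReal T * p (T * (x - m))) := by
        refine lintegral_mono_ae ?_
        have hae : ∀ᵐ x : ℝ, x ≠ c := by simp [ae_iff, measure_singleton]
        filter_upwards [hae] with x hx
        have h1 := hpt (T * (x - c)) (T * bracket (x - c))
          (mul_ne_zero hT.ne' (sub_ne_zero.2 hx)) (by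
            rw [abs_mul, abs_of_pos hT]; gcongr; exact abs_le_bracket _)
        have h2 : p (T * (x - m)) ≤ 1 := by
          simp only [p]
          rw [ENNReal.ofReal_le_one]
          exact inv_le_one_of_one_le₀ (one_le_pow₀ (by linarith [abs_nonneg (T * (x - m))]))
        rw [hk]
        calc ENNReal.ofReal (loss T (bracket (x - c)) ^ q) * (ENNReal.ofReal T * p (T * (x - m)))
            ≤ (2 * (f (T * (x - c)) + f (-(T * (x - c))) + 1)) *
                (ENNReal.ofReal T * p (T * (x - m))) := by gcongr; exact h1
          _ = 2 * (ENNReal.ofReal T * f (T * (x - c)) * p (T * (x - m)) +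
                ENNReal.ofReal T * f (-(T * (x - c))) * p (T * (x - m))
                + ENNReal.ofReal T * p (T * (x - m))) := by ring
          _ ≤ 2 * (ENNReal.ofReal T * f (T * (x - c)) * 1 +
                ENNReal.ofReal T * f (-(T * (x - c))) * 1
                + ENNReal.ofReal T * p (T * (x - m))) := by gcongr
          _ = _ := by ring
    _ = _ := by
        rw [lintegral_const_mul _ (by fun_prop), lintegral_add_right _ (by fun_prop),
          lintegral_add_right _ (by fun_prop), lintegral_comp_mul_sub hT c hf,
          lintegral_comp_mul_sub hT m hp,
          lintegral_comp_mul_sub hT c (G := fun x => f (-x)) (by fun_prop),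
          lintegral_neg_eq_self f]

/-! ### Cauchy–Schwarz and bounds for positive kernel operators -/

theorem sq_lintegral_le {α : Type*} [MeasurableSpace α] {μ : Measure α} {f : α → ℝ≥0∞}
    (hf : Measurable f) : (∫⁻ a, f a ∂μ) ^ 2 ≤ μ Set.univ * ∫⁻ a, f a ^ 2 ∂μ := by
  have h := ENNReal.lintegral_mul_le_Lp_mul_Lq μ (Real.HolderConjugate.two_two)
    (hf.aemeasurable) (aemeasurable_const (b := (1 : ℝ≥0∞)))
  have h2 := pow_le_pow_left' h 2
  simp only [Pi.mul_apply, mul_one, ENNReal.one_rpow, lintegral_const, one_mul, mul_pow,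
    ← ENNReal.rpow_natCast, ← ENNReal.rpow_mul] at h2
  norm_num at h2
  rw [mul_comm]
  exact_mod_cast h2

/-- Cauchy–Schwarz against the constant 1 for the measure with density `k`. In the two operator
bounds below, the density is the input `g` for `L¹` data and the kernel for `L²` data. -/
theorem sq_lintegral_mul_le {α : Type*} [MeasurableSpace α] {μ : Measure α} {k f : α → ℝ≥0∞}
    (hk : Measurable k) (hf : Measurable f) :
    (∫⁻ a, k a * f a ∂μ) ^ 2 ≤ (∫⁻ a, k a ∂μ) * ∫⁻ a, k a * f a ^ 2 ∂μ := by
  have h := sq_lintegral_le (μ := μ.withDensity k) hf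
  rw [lintegral_withDensity_eq_lintegral_mul _ hk hf,
    lintegral_withDensity_eq_lintegral_mul _ hk (by fun_prop),
    withDensity_apply _ MeasurableSet.univ, Measure.restrict_univ] at h
  exact h

/-- A kernel operator maps `L¹` to weighted `L²`. -/
theorem lintegral_mul_sq_le_of_forall_lintegral_sq {v g : ℝ → ℝ≥0∞} {K : ℝ → ℝ → ℝ≥0∞}
    (hv : Measurable v) (hg : Measurable g) (hK : Measurable (Function.uncurry K)) {A : ℝ≥0∞}
    (hA : ∀ y, ∫⁻ x, v x * K x y ^ 2 ≤ A) :
    ∫⁻ x, v x * (∫⁻ y, K x y * g y) ^ 2 ≤ A * (∫⁻ y, g y) ^ 2 := by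
  have hK' : ∀ x, Measurable (K x) := fun x => hK.of_uncurry_left
  calc ∫⁻ x, v x * (∫⁻ y, K x y * g y) ^ 2
      ≤ ∫⁻ x, (∫⁻ y, g y) * ∫⁻ y, g y * (v x * K x y ^ 2) := by
        refine lintegral_mono fun x => ?_
        have h := sq_lintegral_mul_le (μ := volume) hg (hK' x)
        have h2 : ∫⁻ y, g y * (v x * K x y ^ 2) = v x * ∫⁻ y, g y * K x y ^ 2 := by
          rw [← lintegral_const_mul _ (by have := hK' x; fun_prop)]
          exact lintegral_congr fun y => by ring
        rw [h2]
        calc v x * (∫⁻ y, K x y * g y) ^ 2 = v x * (∫⁻ y, g y * K x y) ^ 2 := by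
              simp only [mul_comm]
          _ ≤ v x * ((∫⁻ y, g y) * ∫⁻ y, g y * K x y ^ 2) := by gcongr
          _ = _ := by ring
    _ = (∫⁻ y, g y) * ∫⁻ x, ∫⁻ y, g y * (v x * K x y ^ 2) := by
        refine lintegral_const_mul _ (Measurable.lintegral_prod_right' (f := fun p : ℝ × ℝ =>
          g p.2 * (v p.1 * Function.uncurry K p ^ 2)) (by fun_prop))
    _ = (∫⁻ y, g y) * ∫⁻ y, g y * ∫⁻ x, v x * K x y ^ 2 := by
        rw [lintegral_lintegral_swap (Measurable.aemeasurable (by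
          show Measurable fun p : ℝ × ℝ => g p.2 * (v p.1 * Function.uncurry K p ^ 2)
          fun_prop))]
        congr 1
        refine lintegral_congr fun y => ?_
        have : Measurable fun x => K x y :=
          hK.comp (f := fun x => (x, y)) (by fun_prop)
        exact lintegral_const_mul _ (by fun_prop)
    _ ≤ (∫⁻ y, g y) * ∫⁻ y, g y * A := by
        gcongr with y
        exact hA y
    _ = _ := by rw [lintegral_mul_const _ hg]; ring

/-- A weighted Schur test. -/
theorem lintegral_mul_sq_le_of_schur {v g : ℝ → ℝ≥0∞} {K : ℝ → ℝ → ℝ≥0∞}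
    (hv : Measurable v) (hg : Measurable g) (hK : Measurable (Function.uncurry K)) {A B : ℝ≥0∞}
    (hA : ∀ y, ∫⁻ x, v x * K x y ≤ A) (hB : ∀ x, ∫⁻ y, K x y ≤ B) :
    ∫⁻ x, v x * (∫⁻ y, K x y * g y) ^ 2 ≤ A * B * ∫⁻ y, g y ^ 2 := by
  have hK' : ∀ x, Measurable (K x) := fun x => hK.of_uncurry_left
  calc ∫⁻ x, v x * (∫⁻ y, K x y * g y) ^ 2
      ≤ ∫⁻ x, B * ∫⁻ y, g y ^ 2 * (v x * K x y) := by
        refine lintegral_mono fun x => ?_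
        have h := sq_lintegral_mul_le (μ := volume) (hK' x) hg
        have h2 : ∫⁻ y, g y ^ 2 * (v x * K x y) = v x * ∫⁻ y, K x y * g y ^ 2 := by
          rw [← lintegral_const_mul _ (by have := hK' x; fun_prop)]
          exact lintegral_congr fun y => by ring
        rw [h2]
        calc v x * (∫⁻ y, K x y * g y) ^ 2
            ≤ v x * ((∫⁻ y, K x y) * ∫⁻ y, K x y * g y ^ 2) := by gcongr
          _ ≤ v x * (B * ∫⁻ y, K x y * g y ^ 2) := by gcongr; exact hB x
          _ = _ := by ring
    _ = B * ∫⁻ x, ∫⁻ y, g y ^ 2 * (v x * K x y) := by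
        refine lintegral_const_mul _ (Measurable.lintegral_prod_right' (f := fun p : ℝ × ℝ =>
          g p.2 ^ 2 * (v p.1 * Function.uncurry K p)) (by fun_prop))
    _ = B * ∫⁻ y, g y ^ 2 * ∫⁻ x, v x * K x y := by
        rw [lintegral_lintegral_swap (Measurable.aemeasurable (by
          show Measurable fun p : ℝ × ℝ => g p.2 ^ 2 * (v p.1 * Function.uncurry K p)
          fun_prop))]
        congr 1
        refine lintegral_congr fun y => ?_
        have : Measurable fun x => K x y :=
          hK.comp (f := fun x => (x, y)) (by fun_prop)
        exact lintegral_const_mul _ (by fun_prop)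
    _ ≤ B * ∫⁻ y, g y ^ 2 * A := by
        gcongr with y
        exact hA y
    _ = _ := by rw [lintegral_mul_const _ (by fun_prop)]; ring

/-! ### Pointwise inequalities for the weights -/

/-- `2κξ` is the difference of the null variables `τ + κξ` and `τ - κξ`. The first is at most `B/T`
with `B = ⟨T(τ + κξ)⟩`, the second at most `D`, and the product on the right equals `2 (D B + B/T)`.
-/
theorem bracket_freq_le {κ T τ ξ : ℝ} (hκ : κ = 1 ∨ κ = -1) (hT : 0 < T) :
    bracket ξ ≤ 2 * (bracket (τ - κ * ξ) * bracket (T * (τ + κ * ξ)) *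
      loss T (bracket (τ - κ * ξ))) := by
  have hD := one_le_bracket (τ - κ * ξ)
  have hD' := abs_le_bracket (τ - κ * ξ)
  have hB := one_le_bracket (T * (τ + κ * ξ))
  have hB' := abs_le_bracket (T * (τ + κ * ξ))
  rw [abs_mul, abs_of_pos hT] at hB'
  set D := bracket (τ - κ * ξ)
  set B := bracket (T * (τ + κ * ξ))
  have hD0 : 0 < D := by linarith
  have h1 : D * B * loss T D = D * B + B / T := by
    unfold loss; field_simp
  have h2 : |τ + κ * ξ| ≤ B / T := by rw [le_div_iff₀ hT]; linarith
  have h3 : 2 * |ξ| ≤ |τ + κ * ξ| + |τ - κ * ξ| := by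
    have h4 : |2 * (κ * ξ)| ≤ |τ + κ * ξ| + |τ - κ * ξ| := by
      calc |2 * (κ * ξ)| = |(τ + κ * ξ) - (τ - κ * ξ)| := by ring_nf
        _ ≤ _ := abs_sub _ _
    have h5 : |2 * (κ * ξ)| = 2 * |ξ| := by
      rcases hκ with h | h <;> simp [h, abs_mul]
    linarith
  have h6 := bracket_le ξ
  have h7 : D ≤ D * B := le_mul_of_one_le_right hD0.le hB
  have h8 : 0 ≤ B / T := by positivity
  rw [h1]
  linarith

/-- Raising the previous bound to the power `s ≤ 0` reverses it. This trades the weight in `τ - κξ`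
for the weight `⟨ξ⟩^s` of the `Y` norm. -/
theorem bracket_rpow_mul_le {κ T τ ξ s : ℝ} (hκ : κ = 1 ∨ κ = -1) (hT : 0 < T)
    (hs : -1 ≤ s) (hs' : s ≤ 0) :
    bracket (τ - κ * ξ) ^ s * bracket (T * (τ + κ * ξ)) ^ s ≤
      2 * bracket ξ ^ s * loss T (bracket (τ - κ * ξ)) ^ (-s) := by
  have h := bracket_freq_le (τ := τ) (ξ := ξ) hκ hT
  have hD := bracket_pos (τ - κ * ξ)
  have hB := bracket_pos (T * (τ + κ * ξ))
  have hV : 0 < loss T (bracket (τ - κ * ξ)) := zero_lt_one.trans_le (one_le_loss hT hD)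
  have h2 := Real.rpow_le_rpow_of_nonpos (bracket_pos ξ) h hs'
  rw [Real.mul_rpow (by positivity) (by positivity), Real.mul_rpow (by positivity) (by positivity),
    Real.mul_rpow (by positivity) (by positivity)] at h2
  have h3 : (2 : ℝ) ^ (-s) ≤ 2 := by
    simpa using Real.rpow_le_rpow_of_exponent_le one_le_two (show -s ≤ 1 by linarith)
  have h4 : (2 : ℝ) ^ (-s) * 2 ^ s = 1 := by
    rw [← Real.rpow_add two_pos]; simp
  have h5 : loss T (bracket (τ - κ * ξ)) ^ (-s) * loss T (bracket (τ - κ * ξ)) ^ s = 1 := by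
    rw [← Real.rpow_add hV]; simp
  set D := bracket (τ - κ * ξ)
  set B := bracket (T * (τ + κ * ξ))
  have hp : 0 < bracket ξ ^ s := Real.rpow_pos_of_pos (bracket_pos ξ) _
  calc D ^ s * B ^ s = (2 : ℝ) ^ (-s) * loss T D ^ (-s) *
        (2 ^ s * (D ^ s * B ^ s * loss T D ^ s)) := by
        linear_combination (-(D ^ s * B ^ s)) * h4 * 1 +
          (-(D ^ s * B ^ s)) * h5 * ((2 : ℝ) ^ (-s) * 2 ^ s)
    _ ≤ (2 : ℝ) ^ (-s) * loss T D ^ (-s) * bracket ξ ^ s := by gcongr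
    _ ≤ 2 * loss T D ^ (-s) * bracket ξ ^ s := by gcongr
    _ = _ := by ring

theorem bracket_le_two_mul_abs {x : ℝ} (hx : 1 ≤ |x|) : bracket x ≤ 2 * |x| := by
  linarith [bracket_le x]

/-- The weight at modulations at most `1 / T`. -/
theorem weight_le_of_low {κ T τ ξ s b : ℝ} (hκ : κ = 1 ∨ κ = -1) (hT : 0 < T) (hT1 : T < 1)
    (hs : -1 ≤ s) (hs' : s ≤ 0) (hb : 0 ≤ b) (hb1 : b ≤ 1)
    (hl : T * |τ + κ * ξ| ≤ 1) :
    bracket (τ - κ * ξ) ^ s * bracket (τ + κ * ξ) ^ b ≤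
      8 * T ^ (-b) * bracket ξ ^ s * loss T (bracket (τ - κ * ξ)) ^ (-s) := by
  have h := bracket_rpow_mul_le (τ := τ) (ξ := ξ) hκ hT hs hs'
  have hD := bracket_pos (τ - κ * ξ)
  set D := bracket (τ - κ * ξ)
  set l := τ + κ * ξ
  have h1 : bracket l ^ b ≤ 2 * T ^ (-b) := by
    have : bracket l ≤ 2 * T⁻¹ := by
      have h2 : |l| ≤ T⁻¹ := by rw [← one_div, le_div_iff₀ hT]; linarith
      have h3 : 1 ≤ T⁻¹ := (one_le_inv₀ hT).2 hT1.le
      linarith [bracket_le l]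
    calc bracket l ^ b ≤ (2 * T⁻¹) ^ b := Real.rpow_le_rpow (bracket_pos _).le this hb
      _ = 2 ^ b * T ^ (-b) := by
        rw [Real.mul_rpow (by positivity) (by positivity), Real.inv_rpow hT.le,
          Real.rpow_neg hT.le]
      _ ≤ _ := by
        gcongr
        simpa using Real.rpow_le_rpow_of_exponent_le one_le_two hb1
  -- At low modulation `⟨Tℓ⟩` is comparable to 1, so the factor needed by `bracket_rpow_mul_le` can
  -- be inserted at no cost.
  have h2 : 1 ≤ 2 * bracket (T * l) ^ s := by
    have h3 : bracket (T * l) ≤ 2 := by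
      have := bracket_le (T * l)
      rw [abs_mul, abs_of_pos hT] at this
      linarith
    have h4 := Real.rpow_le_rpow_of_nonpos (bracket_pos _) h3 hs'
    have h5 : (2 : ℝ) ^ (-1 : ℝ) ≤ 2 ^ s := Real.rpow_le_rpow_of_exponent_le one_le_two hs
    rw [Real.rpow_neg_one] at h5
    linarith
  have hDs : 0 < D ^ s := Real.rpow_pos_of_pos hD _
  have hTb : 0 < T ^ (-b) := Real.rpow_pos_of_pos hT _
  calc D ^ s * bracket l ^ b ≤ D ^ s * (2 * T ^ (-b)) := by gcongr
    _ = D ^ s * (2 * T ^ (-b)) * 1 := by ring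
    _ ≤ D ^ s * (2 * T ^ (-b)) * (2 * bracket (T * l) ^ s) := by gcongr
    _ = 4 * T ^ (-b) * (D ^ s * bracket (T * l) ^ s) := by ring
    _ ≤ 4 * T ^ (-b) * (2 * bracket ξ ^ s * loss T D ^ (-s)) := by gcongr
    _ = _ := by ring

/-- The weight at modulations at least `1 / T`, when one factor is gained. -/
theorem weight_le_of_high {κ T τ ξ s b : ℝ} (hκ : κ = 1 ∨ κ = -1) (hT : 0 < T) (hT1 : T < 1)
    (hs : -1 ≤ s) (hs' : s ≤ 0) (hb : 0 ≤ b) (hb1 : b ≤ 1) (hbs : b - 1 ≤ s)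
    (hl : 1 < T * |τ + κ * ξ|) :
    bracket (τ - κ * ξ) ^ s * bracket (τ + κ * ξ) ^ b * |τ + κ * ξ|⁻¹ * T⁻¹ ≤
      8 * T ^ (-b) * bracket ξ ^ s * loss T (bracket (τ - κ * ξ)) ^ (-s) := by
  have h := bracket_rpow_mul_le (τ := τ) (ξ := ξ) hκ hT hs hs'
  have hD := bracket_pos (τ - κ * ξ)
  set D := bracket (τ - κ * ξ)
  set l := τ + κ * ξ
  have hl0 : 0 < |l| := by
    by_contra h0
    nlinarith
  have hl1 : 1 ≤ |l| := by nlinarith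
  have hDs : 0 < D ^ s := Real.rpow_pos_of_pos hD _
  have hTb : 0 < T ^ (-b) := Real.rpow_pos_of_pos hT _
  have h1 : bracket l ^ b ≤ 2 * |l| ^ b := by
    calc bracket l ^ b ≤ (2 * |l|) ^ b :=
          Real.rpow_le_rpow (bracket_pos _).le (bracket_le_two_mul_abs hl1) hb
      _ = 2 ^ b * |l| ^ b := Real.mul_rpow zero_le_two hl0.le
      _ ≤ _ := by
        gcongr
        simpa using Real.rpow_le_rpow_of_exponent_le one_le_two hb1
  have h2 : |l| ^ b * |l|⁻¹ * T⁻¹ = T ^ (-b) * (T * |l|) ^ (b - 1) := by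
    rw [Real.mul_rpow hT.le hl0.le, ← mul_assoc, ← Real.rpow_add hT, Real.rpow_sub_one hl0.ne']
    have : -b + (b - 1) = -1 := by ring
    rw [this, Real.rpow_neg_one]
    ring
  -- This is where `b ≤ 1 + s` is needed: the decay left after dividing by `|ℓ|` must supply
  -- `⟨Tℓ⟩^s`.
  have h3 : (T * |l|) ^ (b - 1) ≤ 2 * bracket (T * l) ^ s := by
    have h4 : bracket (T * l) ≤ 2 * (T * |l|) := by
      have := bracket_le_two_mul_abs (x := T * l) (by rw [abs_mul, abs_of_pos hT]; exact hl.le)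
      rwa [abs_mul, abs_of_pos hT] at this
    have h5 := Real.rpow_le_rpow_of_nonpos (bracket_pos _) h4 hs'
    rw [Real.mul_rpow zero_le_two (by positivity)] at h5
    have h6 : (2 : ℝ) ^ (-1 : ℝ) ≤ 2 ^ s := Real.rpow_le_rpow_of_exponent_le one_le_two hs
    rw [Real.rpow_neg_one] at h6
    have h7 : (T * |l|) ^ (b - 1) ≤ (T * |l|) ^ s :=
      Real.rpow_le_rpow_of_exponent_le hl.le hbs
    have h8 : 0 < (T * |l|) ^ s := Real.rpow_pos_of_pos (by positivity) _
    nlinarith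
  calc D ^ s * bracket l ^ b * |l|⁻¹ * T⁻¹ ≤ D ^ s * (2 * |l| ^ b) * |l|⁻¹ * T⁻¹ := by gcongr
    _ = 2 * D ^ s * (|l| ^ b * |l|⁻¹ * T⁻¹) := by ring
    _ = 2 * D ^ s * (T ^ (-b) * (T * |l|) ^ (b - 1)) := by rw [h2]
    _ ≤ 2 * D ^ s * (T ^ (-b) * (2 * bracket (T * l) ^ s)) := by gcongr
    _ = 4 * T ^ (-b) * (D ^ s * bracket (T * l) ^ s) := by ring
    _ ≤ 4 * T ^ (-b) * (2 * bracket ξ ^ s * loss T D ^ (-s)) := by gcongr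
    _ = _ := by ring

/-- The weight at modulations at least `1 / T` is moderate at scale `1 / T`, up to a loss at the
other null direction. -/
theorem weight_le_mul_weight {κ T τ τ' ξ s b ε : ℝ} (hT : 0 < T) (hT1 : T < 1)
    (hs : -1 ≤ s) (hs' : s ≤ 0) (hε : 0 ≤ ε) (hb : 0 ≤ b - 1 + ε + 1) (hb1 : b - 1 + ε ≤ 0)
    (hl : 1 < T * |τ + κ * ξ|) :
    bracket (τ - κ * ξ) ^ s * bracket (τ + κ * ξ) ^ b * |τ + κ * ξ|⁻¹ ≤
      2 * T ^ ε * loss T (bracket (τ - κ * ξ)) ^ (-s) * (1 + T * |τ - τ'|) ^ 2 *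
        (bracket (τ' - κ * ξ) ^ s * bracket (τ' + κ * ξ) ^ (b - 1 + ε)) := by
  have hD := bracket_pos (τ - κ * ξ)
  have hV : 0 < loss T (bracket (τ - κ * ξ)) := zero_lt_one.trans_le (one_le_loss hT hD)
  have hA := bracket_le_add (τ' - κ * ξ) (τ - κ * ξ)
  have hB := bracket_le_add (τ' + κ * ξ) (τ + κ * ξ)
  have hA' := bracket_pos (τ' - κ * ξ)
  have hB' := bracket_pos (τ' + κ * ξ)
  rw [show τ - κ * ξ - (τ' - κ * ξ) = τ - τ' by ring] at hA
  rw [show τ + κ * ξ - (τ' + κ * ξ) = τ - τ' by ring] at hB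
  set D := bracket (τ - κ * ξ)
  set l := τ + κ * ξ
  set D' := bracket (τ' - κ * ξ)
  set l' := τ' + κ * ξ
  set a := b - 1 + ε with ha
  set J := 1 + T * |τ - τ'| with hJ
  have hJ1 : 1 ≤ J := by have : 0 ≤ T * |τ - τ'| := by positivity
                         linarith
  have hJ0 : 0 < J := by linarith
  have hl0 : 0 < |l| := by
    by_contra h0
    nlinarith
  have hl1 : 1 ≤ |l| := by nlinarith
  have hlb := bracket_pos l
  have hTl : T⁻¹ ≤ bracket l := by
    refine le_trans ?_ (abs_le_bracket l)
    rw [← one_div, div_le_iff₀ hT]; linarith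
  -- `D * loss T D = D + 1/T`: a shift of `τ` by `1/T` may exceed `D`, so moderateness at this scale
  -- holds only for `D + 1/T`. The other bracket is already at least `1/T` and needs no loss.
  have h1 : D' ≤ D * loss T D * J := by
    have : D * loss T D * J = D + T⁻¹ + D * (T * |τ - τ'|) + |τ - τ'| := by
      rw [hJ]; unfold loss; field_simp; ring
    have h' : 0 ≤ T⁻¹ := by positivity
    have h'' : 0 ≤ D * (T * |τ - τ'|) := by positivity
    linarith
  have h2 : bracket l' ≤ bracket l * J := by
    have : |τ - τ'| ≤ bracket l * (T * |τ - τ'|) := by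
      calc |τ - τ'| = T⁻¹ * (T * |τ - τ'|) := by field_simp
        _ ≤ _ := by gcongr
    rw [hJ]; linarith
  have h3 : D ^ s ≤ D' ^ s * loss T D ^ (-s) * J := by
    have h := Real.rpow_le_rpow_of_nonpos hA' h1 hs'
    rw [Real.mul_rpow (by positivity) (by positivity),
      Real.mul_rpow (by positivity) (by positivity)] at h
    have e1 : loss T D ^ s * loss T D ^ (-s) = 1 := by rw [← Real.rpow_add hV]; simp
    have e2 : J ^ s * J ^ (-s) = 1 := by rw [← Real.rpow_add hJ0]; simp
    have e3 : J ^ (-s) ≤ J := by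
      simpa using Real.rpow_le_rpow_of_exponent_le hJ1 (show -s ≤ 1 by linarith)
    calc D ^ s = D ^ s * (loss T D ^ s * loss T D ^ (-s)) * (J ^ s * J ^ (-s)) := by
          rw [e1, e2]; ring
      _ = (D ^ s * loss T D ^ s * J ^ s) * loss T D ^ (-s) * J ^ (-s) := by ring
      _ ≤ _ := by gcongr
  have h4 : bracket l ^ a ≤ bracket l' ^ a * J := by
    have h := Real.rpow_le_rpow_of_nonpos hB' h2 hb1
    rw [Real.mul_rpow (by positivity) (by positivity)] at h
    have e2 : J ^ a * J ^ (-a) = 1 := by rw [← Real.rpow_add hJ0]; simp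
    have e3 : J ^ (-a) ≤ J := by
      simpa using Real.rpow_le_rpow_of_exponent_le hJ1 (show -a ≤ 1 by linarith)
    calc bracket l ^ a = bracket l ^ a * (J ^ a * J ^ (-a)) := by rw [e2]; ring
      _ = (bracket l ^ a * J ^ a) * J ^ (-a) := by ring
      _ ≤ _ := by gcongr
  have h5 : bracket l ^ b * |l|⁻¹ ≤ 2 * (T ^ ε * bracket l ^ a) := by
    -- Source of the factor `T^ε`: of the full power gained from `|ℓ|⁻¹`, the part `ε` is spent
    -- using `⟨ℓ⟩ ≥ 1/T`.
    have e1 : bracket l ^ (-ε) ≤ T ^ ε := by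
      have := Real.rpow_le_rpow_of_nonpos (by positivity) hTl (show -ε ≤ 0 by linarith)
      rwa [Real.inv_rpow hT.le, Real.rpow_neg hT.le, inv_inv] at this
    have e2 : bracket l ^ b = bracket l * (bracket l ^ (-ε) * bracket l ^ a) := by
      rw [← Real.rpow_add hlb]
      nth_rewrite 2 [← Real.rpow_one (bracket l)]
      rw [← Real.rpow_add hlb]
      congr 1; rw [ha]; ring
    have e3 : bracket l * |l|⁻¹ ≤ 2 := by
      rw [← div_eq_mul_inv, div_le_iff₀ hl0]; exact bracket_le_two_mul_abs hl1
    calc bracket l ^ b * |l|⁻¹ = (bracket l * |l|⁻¹) * (bracket l ^ (-ε) * bracket l ^ a) := by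
          rw [e2]; ring
      _ ≤ 2 * (T ^ ε * bracket l ^ a) := by gcongr
  have hDs : 0 < D ^ s := Real.rpow_pos_of_pos hD _
  have hDs' : 0 < D' ^ s := Real.rpow_pos_of_pos hA' _
  have hTe : 0 < T ^ ε := Real.rpow_pos_of_pos hT _
  calc D ^ s * bracket l ^ b * |l|⁻¹ = D ^ s * (bracket l ^ b * |l|⁻¹) := by ring
    _ ≤ (D' ^ s * loss T D ^ (-s) * J) * (2 * (T ^ ε * bracket l ^ a)) := by gcongr
    _ ≤ (D' ^ s * loss T D ^ (-s) * J) * (2 * (T ^ ε * (bracket l' ^ a * J))) := by gcongr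
    _ = _ := by ring

/-! ### Weighted bounds for the time-frequency operators -/

/-- The operator with kernel `kern n T (τ - τ')` in the time frequency. -/
noncomputable def kernOp (n : ℕ) (T : ℝ) (u : ℝ × ℝ → ℝ≥0∞) (p : ℝ × ℝ) : ℝ≥0∞ :=
  ∫⁻ y, ENNReal.ofReal (kern n T (p.1 - y)) * u (y, p.2)

theorem measurable_kernOp (n : ℕ) (T : ℝ) {u : ℝ × ℝ → ℝ≥0∞} (hu : Measurable u) :
    Measurable (kernOp n T u) :=
  Measurable.lintegral_prod_right' (f := fun q : (ℝ × ℝ) × ℝ =>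
    ENNReal.ofReal (kern n T (q.1.1 - q.2)) * u (q.2, q.1.2)) (by fun_prop)

/-- The `L¹ → L²` norm involves the square of the kernel; the spare factor `T` here becomes the gain
`T^(1/2)`. -/
theorem kern_four_sq_le {T : ℝ} (hT : 0 < T) (ν : ℝ) : kern 4 T ν ^ 2 ≤ T * kern 2 T ν := by
  unfold kern
  have hJ : 1 ≤ 1 + T * |ν| := by have : 0 ≤ T * |ν| := by positivity
                                  linarith
  have h : ((1 + T * |ν|) ^ 8)⁻¹ ≤ ((1 + T * |ν|) ^ 2)⁻¹ :=
    inv_anti₀ (by positivity) (pow_le_pow_right₀ hJ (by norm_num))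
  calc (T * ((1 + T * |ν|) ^ 4)⁻¹) ^ 2 = T ^ 2 * ((1 + T * |ν|) ^ 8)⁻¹ := by
        rw [mul_pow, inv_pow, ← pow_mul]
    _ ≤ T ^ 2 * ((1 + T * |ν|) ^ 2)⁻¹ := by gcongr
    _ = _ := by ring

/-- For fixed `ξ` this is the `L¹ → L²` bound with weight `V^(-2s)`, `V` being the loss; squaring
`V^(-s)` is what forces `-2s < 1`. -/
theorem exists_lintegral_loss_kernOp_four_le {s : ℝ} (hs : -1 / 2 < s) (hs' : s ≤ 0) :
    ∃ C : ℝ≥0, ∀ κ T : ℝ, 0 < T → ∀ u : ℝ × ℝ → ℝ≥0∞, Measurable u →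
      ∫⁻ p : ℝ × ℝ, (ENNReal.ofReal (bracket p.2 ^ s * loss T (bracket (p.1 - κ * p.2)) ^ (-s)) *
        kernOp 4 T u p) ^ 2 ≤
      C * ENNReal.ofReal T * ∫⁻ ξ, (∫⁻ τ, ENNReal.ofReal (bracket ξ ^ s) * u (τ, ξ)) ^ 2 := by
  obtain ⟨C, hC⟩ := exists_lintegral_loss_kern_le (q := -(2 * s)) (by linarith) (by linarith)
  refine ⟨C, fun κ T hT u hu => ?_⟩
  have hK := measurable_kernOp 4 T hu
  rw [Measure.volume_eq_prod, lintegral_prod_symm' _ (by fun_prop),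
    ← lintegral_const_mul _ (by fun_prop)]
  refine lintegral_mono fun ξ => ?_
  have hu' : Measurable fun τ => u (τ, ξ) := by fun_prop
  have key := lintegral_mul_sq_le_of_forall_lintegral_sq
    (v := fun τ => ENNReal.ofReal (loss T (bracket (τ - κ * ξ)) ^ (-(2 * s))))
    (g := fun τ => u (τ, ξ)) (K := fun x y => ENNReal.ofReal (kern 4 T (x - y)))
    (A := C * ENNReal.ofReal T) (by fun_prop) hu' (by
      show Measurable fun p : ℝ × ℝ => ENNReal.ofReal (kern 4 T (p.1 - p.2))
      fun_prop) (fun y => by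
      calc ∫⁻ x, ENNReal.ofReal (loss T (bracket (x - κ * ξ)) ^ (-(2 * s))) *
              ENNReal.ofReal (kern 4 T (x - y)) ^ 2
          ≤ ∫⁻ x, ENNReal.ofReal (loss T (bracket (x - κ * ξ)) ^ (-(2 * s))) *
              ENNReal.ofReal (kern 2 T (x - y)) * ENNReal.ofReal T := by
            refine lintegral_mono fun x => ?_
            rw [mul_assoc, ← ENNReal.ofReal_mul (kern_nonneg 2 hT _),
              ← ENNReal.ofReal_pow (kern_nonneg 4 hT _), mul_comm (kern 2 T _)]
            gcongr
            exact kern_four_sq_le hT _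
        _ ≤ _ := by
            rw [lintegral_mul_const _ (by fun_prop)]
            gcongr
            exact hC T hT _ _)
  calc ∫⁻ τ, (ENNReal.ofReal (bracket ξ ^ s * loss T (bracket (τ - κ * ξ)) ^ (-s)) *
        kernOp 4 T u (τ, ξ)) ^ 2
      = ∫⁻ τ, ENNReal.ofReal (bracket ξ ^ s) ^ 2 *
        (ENNReal.ofReal (loss T (bracket (τ - κ * ξ)) ^ (-(2 * s))) *
          (∫⁻ y, ENNReal.ofReal (kern 4 T (τ - y)) * u (y, ξ)) ^ 2) := by
        refine lintegral_congr fun τ => ?_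
        have hV : 0 ≤ loss T (bracket (τ - κ * ξ)) :=
          zero_le_one.trans (one_le_loss hT (bracket_pos _))
        have h1 : loss T (bracket (τ - κ * ξ)) ^ (-(2 * s)) =
            (loss T (bracket (τ - κ * ξ)) ^ (-s)) ^ 2 := by
          rw [← Real.rpow_mul_natCast hV]; congr 1; push_cast; ring
        rw [h1, ENNReal.ofReal_mul (Real.rpow_nonneg (bracket_pos _).le _),
          ENNReal.ofReal_pow (Real.rpow_nonneg hV _), kernOp]
        ring
    _ = ENNReal.ofReal (bracket ξ ^ s) ^ 2 *
        ∫⁻ τ, (ENNReal.ofReal (loss T (bracket (τ - κ * ξ)) ^ (-(2 * s))) *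
          (∫⁻ y, ENNReal.ofReal (kern 4 T (τ - y)) * u (y, ξ)) ^ 2) := by
        refine lintegral_const_mul _ ?_
        have := hK.comp (show Measurable fun τ : ℝ => (τ, ξ) by fun_prop)
        have h2 : Measurable fun τ => ∫⁻ y, ENNReal.ofReal (kern 4 T (τ - y)) * u (y, ξ) := this
        fun_prop
    _ ≤ ENNReal.ofReal (bracket ξ ^ s) ^ 2 *
        (C * ENNReal.ofReal T * (∫⁻ τ, u (τ, ξ)) ^ 2) := by gcongr
    _ = _ := by rw [lintegral_const_mul _ hu']; ring

/-- Schur's test for fixed `ξ`, with the loss carried by one of the two marginal integrals only. -/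
theorem exists_lintegral_loss_kernOp_two_le {s : ℝ} (hs : -1 / 2 < s) (hs' : s ≤ 0) :
    ∃ C : ℝ≥0, ∀ κ T : ℝ, 0 < T → ∀ u : ℝ × ℝ → ℝ≥0∞, Measurable u →
      ∫⁻ p : ℝ × ℝ, (ENNReal.ofReal (loss T (bracket (p.1 - κ * p.2)) ^ (-s)) *
        kernOp 2 T u p) ^ 2 ≤ C * ∫⁻ p, u p ^ 2 := by
  obtain ⟨C, hC⟩ := exists_lintegral_loss_kern_le (q := -(2 * s)) (by linarith) (by linarith)
  refine ⟨C * C, fun κ T hT u hu => ?_⟩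
  have hK := measurable_kernOp 2 T hu
  rw [Measure.volume_eq_prod, lintegral_prod_symm' _ (by fun_prop),
    lintegral_prod_symm' _ (by fun_prop), ← lintegral_const_mul _ (by fun_prop)]
  refine lintegral_mono fun ξ => ?_
  have hu' : Measurable fun τ => u (τ, ξ) := by fun_prop
  have key := lintegral_mul_sq_le_of_schur
    (v := fun τ => ENNReal.ofReal (loss T (bracket (τ - κ * ξ)) ^ (-(2 * s))))
    (g := fun τ => u (τ, ξ)) (K := fun x y => ENNReal.ofReal (kern 2 T (x - y)))
    (A := C) (B := C) (by fun_prop) hu' (by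
      show Measurable fun p : ℝ × ℝ => ENNReal.ofReal (kern 2 T (p.1 - p.2))
      fun_prop) (fun y => hC T hT _ _) (fun x => by
      refine le_trans (lintegral_mono fun y => ?_) (hC T hT 0 x)
      -- The unweighted marginal follows from the weighted one with an arbitrary centre, here 0,
      -- since the weight is at least 1.
      have h1 : (1 : ℝ) ≤ loss T (bracket (y - 0)) ^ (-(2 * s)) :=
        Real.one_le_rpow (one_le_loss hT (bracket_pos _)) (by linarith)
      have h2 : kern 2 T (x - y) = kern 2 T (y - x) := by
        unfold kern; rw [abs_sub_comm]
      rw [h2]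
      exact le_mul_of_one_le_left' (ENNReal.one_le_ofReal.2 h1))
  rw [ENNReal.coe_mul]
  refine le_trans (le_of_eq (lintegral_congr fun τ => ?_)) key
  have hV : 0 ≤ loss T (bracket (τ - κ * ξ)) :=
    zero_le_one.trans (one_le_loss hT (bracket_pos _))
  have h1 : loss T (bracket (τ - κ * ξ)) ^ (-(2 * s)) =
      (loss T (bracket (τ - κ * ξ)) ^ (-s)) ^ 2 := by
    rw [← Real.rpow_mul_natCast hV]; congr 1; push_cast; ring
  simp only [h1]
  rw [ENNReal.ofReal_pow (Real.rpow_nonneg hV _), kernOp]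
  ring

/-! ### The energy estimate from pointwise bounds -/

theorem rpow_half_sq_le {a b c : ℝ≥0∞} (h : a ≤ c ^ 2 * b) :
    a ^ (1 / 2 : ℝ) ≤ c * b ^ (1 / 2 : ℝ) := by
  refine (ENNReal.rpow_le_rpow h (by norm_num)).trans_eq ?_
  rw [ENNReal.mul_rpow_of_nonneg _ _ (by norm_num), ← ENNReal.rpow_natCast, ← ENNReal.rpow_mul]
  norm_num

theorem ofReal_rpow_sq {T : ℝ} (hT : 0 < T) (a : ℝ) :
    ENNReal.ofReal (T ^ a) ^ 2 = ENNReal.ofReal (T ^ (2 * a)) := by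
  rw [← ENNReal.ofReal_pow (Real.rpow_nonneg hT.le _), ← Real.rpow_mul_natCast hT.le]
  congr 2; push_cast; ring

/-- The energy estimate in terms of pointwise bounds for the Fourier transform of the solution. -/
theorem exists_weighted_norm_le {s ε b : ℝ} (hs : -1 / 2 < s) (hs' : s ≤ 0) (hε : 0 < ε)
    (hb : 1 / 2 < b) (hbs : b < 1 + s) (hbε : b < 1 - ε) (A : ℝ≥0) :
    ∃ C : ℝ≥0, 1 ≤ C ∧ ∀ κ T : ℝ, (κ = 1 ∨ κ = -1) → 0 < T → T < 1 → ∀ h g f : ℝ × ℝ → ℝ≥0∞,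
      Measurable g → Measurable f →
      (∀ᵐ p, h p ≤ A * kernOp 4 T g p) →
      (∀ᵐ p : ℝ × ℝ, ENNReal.ofReal |p.1 + κ * p.2| * h p ≤
        A * (ENNReal.ofReal T⁻¹ * kernOp 4 T g p + kernOp 4 T f p)) →
      (∫⁻ p : ℝ × ℝ, (ENNReal.ofReal (bracket (p.1 - κ * p.2) ^ s * bracket (p.1 + κ * p.2) ^ b) *
        h p) ^ (2 : ℝ)) ^ (1 / 2 : ℝ) ≤
      C * (ENNReal.ofReal (T ^ (1 / 2 - b)) *
        (∫⁻ ξ, (∫⁻ τ, ENNReal.ofReal (bracket ξ ^ s) * g (τ, ξ)) ^ (2 : ℝ)) ^ (1 / 2 : ℝ) +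
        ENNReal.ofReal (T ^ ε) * (∫⁻ p : ℝ × ℝ,
          (ENNReal.ofReal (bracket (p.1 - κ * p.2) ^ s * bracket (p.1 + κ * p.2) ^ (b - 1 + ε)) *
            f p) ^ (2 : ℝ)) ^ (1 / 2 : ℝ)) := by
  obtain ⟨C₁, hC₁⟩ := exists_lintegral_loss_kernOp_four_le hs hs'
  obtain ⟨C₂, hC₂⟩ := exists_lintegral_loss_kernOp_two_le hs hs'
  refine ⟨1 + (A * 8) * (1 + C₁) + (A * 2) * (1 + C₂), ?_, ?_⟩
  · rw [add_assoc]; exact le_self_add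
  intro κ T hκ hT hT1 h g f hg hf hlow hhigh
  have hKg := measurable_kernOp 4 T hg
  have hfw : Measurable fun p : ℝ × ℝ => ENNReal.ofReal (bracket (p.1 - κ * p.2) ^ s *
    bracket (p.1 + κ * p.2) ^ (b - 1 + ε)) * f p := by fun_prop
  set fw : ℝ × ℝ → ℝ≥0∞ := fun p => ENNReal.ofReal (bracket (p.1 - κ * p.2) ^ s *
    bracket (p.1 + κ * p.2) ^ (b - 1 + ε)) * f p with hfw_def
  have hKf := measurable_kernOp 2 T hfw
  -- `X` majorizes the contribution of `g` in both modulation regions, `Y` that of `f`, which occurs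
  -- only at high modulation.
  let X : ℝ × ℝ → ℝ≥0∞ := fun p => (A * 8 : ℝ≥0) * ENNReal.ofReal (T ^ (-b)) *
    (ENNReal.ofReal (bracket p.2 ^ s * loss T (bracket (p.1 - κ * p.2)) ^ (-s)) * kernOp 4 T g p)
  let Y : ℝ × ℝ → ℝ≥0∞ := fun p => (A * 2 : ℝ≥0) * ENNReal.ofReal (T ^ ε) *
    (ENNReal.ofReal (loss T (bracket (p.1 - κ * p.2)) ^ (-s)) * kernOp 2 T fw p)
  have hX : Measurable X := by fun_prop
  have hY : Measurable Y := by fun_prop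
  have hpt : ∀ᵐ p : ℝ × ℝ, ENNReal.ofReal (bracket (p.1 - κ * p.2) ^ s *
      bracket (p.1 + κ * p.2) ^ b) * h p ≤ (X + Y) p := by
    filter_upwards [hlow, hhigh] with p h1 h2
    obtain ⟨τ, ξ⟩ := p
    simp only [Pi.add_apply] at *
    have e8 : ENNReal.ofReal (8 * T ^ (-b) * bracket ξ ^ s *
        loss T (bracket (τ - κ * ξ)) ^ (-s)) = 8 * (ENNReal.ofReal (T ^ (-b)) *
        ENNReal.ofReal (bracket ξ ^ s * loss T (bracket (τ - κ * ξ)) ^ (-s))) := by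
      rw [← ENNReal.ofReal_mul (by positivity),
        show (8 : ℝ≥0∞) = ENNReal.ofReal 8 by simp, ← ENNReal.ofReal_mul (by norm_num)]
      congr 1; ring
    rcases le_or_gt (T * |τ + κ * ξ|) 1 with hl | hl
    · refine le_trans ?_ le_self_add
      have hw := ENNReal.ofReal_le_ofReal (weight_le_of_low (s := s) (b := b) hκ hT hT1
        (by linarith) hs' (by linarith) (by linarith) hl)
      calc _ ≤ ENNReal.ofReal (8 * T ^ (-b) * bracket ξ ^ s *
            loss T (bracket (τ - κ * ξ)) ^ (-s)) * (A * kernOp 4 T g (τ, ξ)) := by gcongr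
        _ = _ := by
          rw [e8]
          simp only [X]
          push_cast
          ring
    · have hl0 : 0 < |τ + κ * ξ| := by
        by_contra h0
        nlinarith
      have h3 : h (τ, ξ) = ENNReal.ofReal |τ + κ * ξ|⁻¹ *
          (ENNReal.ofReal |τ + κ * ξ| * h (τ, ξ)) := by
        rw [← mul_assoc, ← ENNReal.ofReal_mul (by positivity), inv_mul_cancel₀ hl0.ne']
        simp
      have hbr : 0 ≤ bracket (τ - κ * ξ) ^ s * bracket (τ + κ * ξ) ^ b :=
        mul_nonneg (Real.rpow_nonneg (bracket_pos _).le _) (Real.rpow_nonneg (bracket_pos _).le _)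
      have hw1 := ENNReal.ofReal_le_ofReal (weight_le_of_high (s := s) (b := b) hκ hT hT1
        (by linarith) hs' (by linarith) (by linarith) (by linarith) hl)
      rw [ENNReal.ofReal_mul (by positivity), e8] at hw1
      have hw2 : ENNReal.ofReal (bracket (τ - κ * ξ) ^ s * bracket (τ + κ * ξ) ^ b *
          |τ + κ * ξ|⁻¹) * kernOp 4 T f (τ, ξ) ≤ 2 * ENNReal.ofReal (T ^ ε) *
          (ENNReal.ofReal (loss T (bracket (τ - κ * ξ)) ^ (-s)) * kernOp 2 T fw (τ, ξ)) := by
        simp only [kernOp]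
        have m1 : Measurable fun y => ENNReal.ofReal (kern 4 T (τ - y)) * f (y, ξ) := by fun_prop
        have m2 : Measurable fun y => ENNReal.ofReal (kern 2 T (τ - y)) * fw (y, ξ) := by fun_prop
        rw [← lintegral_const_mul _ m1, ← lintegral_const_mul _ m2,
          ← lintegral_const_mul _ (by fun_prop)]
        refine lintegral_mono fun τ' => ?_
        have hV : 0 ≤ loss T (bracket (τ - κ * ξ)) :=
          zero_le_one.trans (one_le_loss hT (bracket_pos _))
        have hV' := Real.rpow_nonneg hV (-s)
        have hw := weight_le_mul_weight (κ := κ) (τ := τ) (ξ := ξ) (τ' := τ') (b := b) hT hT1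
          (by linarith) hs' hε.le (by linarith) (by linarith) hl
        -- Moving the two brackets from `τ` to `τ'` costs two powers of `1 + T|τ - τ'|`, which the
        -- fourth-order decay absorbs, leaving the integrable kernel of order 2.
        have hJ : kern 4 T (τ - τ') * (1 + T * |τ - τ'|) ^ 2 = kern 2 T (τ - τ') := by
          unfold kern
          have : (0 : ℝ) < 1 + T * |τ - τ'| := by positivity
          field_simp
        have hw' : 0 ≤ bracket (τ' - κ * ξ) ^ s * bracket (τ' + κ * ξ) ^ (b - 1 + ε) :=
          mul_nonneg (Real.rpow_nonneg (bracket_pos _).le _)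
            (Real.rpow_nonneg (bracket_pos _).le _)
        simp only [hfw_def]
        calc _ = ENNReal.ofReal (bracket (τ - κ * ξ) ^ s * bracket (τ + κ * ξ) ^ b *
              |τ + κ * ξ|⁻¹ * kern 4 T (τ - τ')) * f (τ', ξ) := by
              rw [ENNReal.ofReal_mul (q := kern 4 T (τ - τ')) (by positivity)]; ring
          _ ≤ ENNReal.ofReal (2 * (T ^ ε * (loss T (bracket (τ - κ * ξ)) ^ (-s) *
                (kern 2 T (τ - τ') * (bracket (τ' - κ * ξ) ^ s *
                  bracket (τ' + κ * ξ) ^ (b - 1 + ε)))))) * f (τ', ξ) := by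
              gcongr ENNReal.ofReal ?_ * _
              rw [← hJ]
              have := mul_le_mul_of_nonneg_right hw (kern_nonneg 4 hT (τ - τ'))
              refine this.trans_eq ?_
              ring
          _ = _ := by
              rw [ENNReal.ofReal_mul (by norm_num), ENNReal.ofReal_mul (by positivity),
                ENNReal.ofReal_mul hV', ENNReal.ofReal_mul (kern_nonneg 2 hT _)]
              simp only [ENNReal.ofReal_ofNat]
              ring
      rw [h3]
      calc _ ≤ ENNReal.ofReal (bracket (τ - κ * ξ) ^ s * bracket (τ + κ * ξ) ^ b) *
            (ENNReal.ofReal |τ + κ * ξ|⁻¹ * (A * (ENNReal.ofReal T⁻¹ * kernOp 4 T g (τ, ξ) +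
              kernOp 4 T f (τ, ξ)))) := by gcongr
        _ = A * (ENNReal.ofReal (bracket (τ - κ * ξ) ^ s * bracket (τ + κ * ξ) ^ b *
              |τ + κ * ξ|⁻¹) * ENNReal.ofReal T⁻¹ * kernOp 4 T g (τ, ξ)) +
            A * (ENNReal.ofReal (bracket (τ - κ * ξ) ^ s * bracket (τ + κ * ξ) ^ b *
              |τ + κ * ξ|⁻¹) * kernOp 4 T f (τ, ξ)) := by
            rw [ENNReal.ofReal_mul hbr]; ring
        _ ≤ A * (8 * (ENNReal.ofReal (T ^ (-b)) *
              ENNReal.ofReal (bracket ξ ^ s * loss T (bracket (τ - κ * ξ)) ^ (-s))) *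
              kernOp 4 T g (τ, ξ)) +
            A * (2 * ENNReal.ofReal (T ^ ε) *
          (ENNReal.ofReal (loss T (bracket (τ - κ * ξ)) ^ (-s)) * kernOp 2 T fw (τ, ξ))) := by
            gcongr
        _ = _ := by
            simp only [X, Y]
            push_cast
            ring
  -- Majorizing by a perfect square avoids square roots of the constants.
  have hsq : ∀ c : ℝ≥0, (c : ℝ≥0∞) ≤ (1 + c) ^ 2 := fun c => by
    calc (c : ℝ≥0∞) ≤ 1 + c := le_add_self
      _ ≤ (1 + c) ^ 2 := le_self_pow₀ le_self_add two_ne_zero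
  have hXn : (∫⁻ p, X p ^ (2 : ℝ)) ^ (1 / 2 : ℝ) ≤
      (A * 8 : ℝ≥0) * (1 + C₁) * ENNReal.ofReal (T ^ (1 / 2 - b)) *
        (∫⁻ ξ, (∫⁻ τ, ENNReal.ofReal (bracket ξ ^ s) * g (τ, ξ)) ^ (2 : ℝ)) ^ (1 / 2 : ℝ) := by
    refine rpow_half_sq_le ?_
    simp only [ENNReal.rpow_two, X, mul_pow ((A * 8 : ℝ≥0) * ENNReal.ofReal (T ^ (-b)))]
    rw [lintegral_const_mul _ (by fun_prop)]
    calc _ ≤ ((A * 8 : ℝ≥0) * ENNReal.ofReal (T ^ (-b))) ^ 2 * (C₁ * ENNReal.ofReal T *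
          ∫⁻ ξ, (∫⁻ τ, ENNReal.ofReal (bracket ξ ^ s) * g (τ, ξ)) ^ 2) := by
          gcongr; exact hC₁ κ T hT g hg
      _ ≤ ((A * 8 : ℝ≥0) * ENNReal.ofReal (T ^ (-b))) ^ 2 * ((1 + C₁) ^ 2 * ENNReal.ofReal T *
          ∫⁻ ξ, (∫⁻ τ, ENNReal.ofReal (bracket ξ ^ s) * g (τ, ξ)) ^ 2) := by
          gcongr; exact hsq C₁
      _ = _ := by
          -- The weight gives `T^(-b)`, the squared operator norm gives `T`.
          have hTT : ENNReal.ofReal (T ^ (1 / 2 - b)) ^ 2 =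
              ENNReal.ofReal (T ^ (-b)) ^ 2 * ENNReal.ofReal T := by
            rw [ofReal_rpow_sq hT, ofReal_rpow_sq hT, ← ENNReal.ofReal_mul (by positivity)]
            congr 1
            nth_rewrite 3 [← Real.rpow_one T]
            rw [← Real.rpow_add hT]
            congr 1; ring
          rw [mul_pow _ (ENNReal.ofReal (T ^ (1 / 2 - b))), hTT]
          ring
  have hYn : (∫⁻ p, Y p ^ (2 : ℝ)) ^ (1 / 2 : ℝ) ≤
      (A * 2 : ℝ≥0) * (1 + C₂) * ENNReal.ofReal (T ^ ε) *
        (∫⁻ p, fw p ^ (2 : ℝ)) ^ (1 / 2 : ℝ) := by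
    refine rpow_half_sq_le ?_
    simp only [ENNReal.rpow_two, Y, mul_pow ((A * 2 : ℝ≥0) * ENNReal.ofReal (T ^ ε))]
    rw [lintegral_const_mul _ (by fun_prop)]
    calc _ ≤ ((A * 2 : ℝ≥0) * ENNReal.ofReal (T ^ ε)) ^ 2 * (C₂ * ∫⁻ p, fw p ^ 2) := by
          gcongr; exact hC₂ κ T hT fw hfw
      _ ≤ ((A * 2 : ℝ≥0) * ENNReal.ofReal (T ^ ε)) ^ 2 * ((1 + C₂) ^ 2 * ∫⁻ p, fw p ^ 2) := by
          gcongr; exact hsq C₂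
      _ = _ := by ring
  calc _ ≤ (∫⁻ p, (X + Y) p ^ (2 : ℝ)) ^ (1 / 2 : ℝ) := by
        refine ENNReal.rpow_le_rpow (lintegral_mono_ae ?_) (by norm_num)
        filter_upwards [hpt] with p hp
        exact ENNReal.rpow_le_rpow hp (by norm_num)
    _ ≤ _ := ENNReal.lintegral_Lp_add_le hX.aemeasurable hY.aemeasurable (by norm_num)
    _ ≤ _ := add_le_add hXn hYn
    _ ≤ _ := by
        rw [mul_add _ (ENNReal.ofReal (T ^ (1 / 2 - b)) * _), ← mul_assoc, ← mul_assoc]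
        push_cast
        gcongr
        · refine le_trans ?_ le_self_add
          exact le_add_self
        · exact le_add_self

/-! ### Coordinates on space-time -/

theorem pt_eq (p : ℝ × ℝ) : pt p.1 p.2 = (WithLp.prodContinuousLinearEquiv 2 ℝ ℝ ℝ).symm p := rfl

@[fun_prop]
theorem continuous_pt : Continuous fun p : ℝ × ℝ => pt p.1 p.2 :=
  (WithLp.prodContinuousLinearEquiv 2 ℝ ℝ ℝ).symm.continuous

theorem inner_pt (x : Spacetime) (τ ξ : ℝ) : inner ℝ x (pt τ ξ) = x.fst * τ + x.snd * ξ := by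
  simp [pt, WithLp.prod_inner_apply, mul_comm]

/-! ### Convolution in the time frequency -/

/-- The Fourier transform of `t ↦ η (t / T)`. -/
noncomputable def cutoffHat (η : 𝓢(ℝ, ℂ)) (T ν : ℝ) : ℂ := T * (𝓕 η) (T * ν)

@[fun_prop]
theorem continuous_cutoffHat (η : 𝓢(ℝ, ℂ)) (T : ℝ) : Continuous (cutoffHat η T) := by
  unfold cutoffHat
  have := (𝓕 η).continuous
  fun_prop

theorem exists_norm_mul_pow_le {E F : Type*} [NormedAddCommGroup E] [NormedSpace ℝ E]
    [NormedAddCommGroup F] [NormedSpace ℝ F] (φ : 𝓢(E, F)) (N : ℕ) :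
    ∃ C : ℝ, 0 ≤ C ∧ ∀ x, ‖φ x‖ ≤ C * ((1 + ‖x‖) ^ N)⁻¹ := by
  refine ⟨2 ^ N * ((Finset.Iic (N, 0)).sup fun m => SchwartzMap.seminorm ℝ m.1 m.2) φ,
    by positivity, fun x => ?_⟩
  have h := SchwartzMap.one_add_le_sup_seminorm_apply (𝕜 := ℝ) (m := (N, 0)) le_rfl le_rfl φ x
  rw [norm_iteratedFDeriv_zero] at h
  rw [← div_eq_mul_inv, le_div_iff₀ (by positivity), mul_comm]
  exact h

/-- Schwartz decay of `𝓕 η` at the point `Tν`; the constant is independent of `T` because scaling is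
built into `kern`. -/
theorem exists_norm_cutoffHat_le (η : 𝓢(ℝ, ℂ)) (N : ℕ) :
    ∃ C : ℝ≥0, ∀ T : ℝ, 0 < T → ∀ ν, ‖cutoffHat η T ν‖ₑ ≤ C * ENNReal.ofReal (kern N T ν) := by
  obtain ⟨C, hC0, hC⟩ := exists_norm_mul_pow_le (𝓕 η) N
  refine ⟨C.toNNReal, fun T hT ν => ?_⟩
  have h := hC (T * ν)
  rw [norm_mul, Real.norm_eq_abs T, abs_of_pos hT, Real.norm_eq_abs] at h
  have h2 : ‖cutoffHat η T ν‖ ≤ C * kern N T ν := by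
    unfold cutoffHat kern
    rw [norm_mul, Complex.norm_real, Real.norm_eq_abs, abs_of_pos hT]
    calc T * ‖(𝓕 η) (T * ν)‖ ≤ T * (C * ((1 + T * |ν|) ^ N)⁻¹) := by gcongr
      _ = _ := by ring
  change _ ≤ ENNReal.ofReal C * _
  rw [← ENNReal.ofReal_mul hC0, ← ofReal_norm]
  exact ENNReal.ofReal_le_ofReal h2

/-- Fourier inversion for a rescaled cutoff. -/
theorem integral_cutoffHat (η : 𝓢(ℝ, ℂ)) {T : ℝ} (hT : 0 < T) (t : ℝ) :
    ∫ ν, (𝐞 (t * ν) : ℂ) * cutoffHat η T ν = η (t / T) := by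
  have h : (𝓕⁻ (𝓕 η)) (t / T) = η (t / T) := by
    rw [FourierTransform.fourierInv_fourier_eq]
  rw [← h, SchwartzMap.fourierInv_coe, Real.fourierInv_eq]
  have h2 := Measure.integral_comp_mul_left
    (fun v : ℝ => (T : ℂ) * ((𝐞 (inner ℝ v (t / T)) : Circle) • (𝓕 η) v)) T
  have h3 : ∀ ν : ℝ, (𝐞 (t * ν) : ℂ) * cutoffHat η T ν =
      (T : ℂ) * ((𝐞 (inner ℝ (T * ν) (t / T)) : Circle) • (𝓕 η) (T * ν)) := by
    intro ν
    have : inner ℝ (T * ν) (t / T) = t * ν := by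
      simp only [RCLike.inner_apply, conj_trivial]; field_simp
    rw [this, Circle.smul_def, cutoffHat, smul_eq_mul]
    ring
  simp_rw [h3]
  rw [h2, integral_const_mul, abs_of_pos (inv_pos.2 hT), Complex.real_smul, ← mul_assoc]
  have : (T : ℂ) ≠ 0 := by exact_mod_cast hT.ne'
  push_cast
  rw [inv_mul_cancel₀ this, one_mul]

theorem integrable_cutoffHat (η : 𝓢(ℝ, ℂ)) {T : ℝ} (hT : 0 < T) :
    Integrable (cutoffHat η T) :=
  ((𝓕 η).integrable (μ := volume)).comp_mul_left' hT.ne' |>.const_mul (T : ℂ)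

/-- The adjoint, on test functions, of multiplying a distribution by the cutoff. Writing `η(t/T)` by
Fourier inversion turns the product into a superposition of modulations, each a shift of `φ` in `τ`;
Fubini exchanges the integrals. -/
theorem fourierInv_cutoff_mul_fourier (η : 𝓢(ℝ, ℂ)) {T : ℝ} (hT : 0 < T)
    (hη : (timeCutoff η T).HasTemperateGrowth) (φ : 𝓢(Spacetime, ℂ)) (τ ξ : ℝ) :
    (𝓕⁻ (SchwartzMap.smulLeftCLM ℂ (timeCutoff η T) (𝓕 φ))) (pt τ ξ) =
      ∫ ν, cutoffHat η T ν * φ (pt (τ + ν) ξ) := by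
  rw [SchwartzMap.fourierInv_coe, Real.fourierInv_eq]
  have hinv : ∀ q : Spacetime, φ q = ∫ x : Spacetime, (𝐞 (inner ℝ x q) : ℂ) * (𝓕 φ) x := by
    intro q
    have h : (𝓕⁻ (𝓕 φ)) q = φ q := by rw [FourierTransform.fourierInv_fourier_eq]
    rw [← h, SchwartzMap.fourierInv_coe, Real.fourierInv_eq]
    rfl
  let H : Spacetime → ℝ → ℂ := fun x ν =>
    (𝐞 (inner ℝ x (pt τ ξ)) : ℂ) * (𝐞 (x.fst * ν) : ℂ) * (cutoffHat η T ν * (𝓕 φ) x)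
  have hH : Integrable (Function.uncurry H) (volume.prod volume) := by
    have h1 : Integrable (fun z : Spacetime × ℝ => (𝓕 φ) z.1 * cutoffHat η T z.2)
        (volume.prod volume) :=
      ((𝓕 φ).integrable).mul_prod (integrable_cutoffHat η hT)
    refine h1.mono ?_ (Filter.Eventually.of_forall fun z => ?_)
    · have := (𝓕 φ).continuous
      have h2 : Continuous fun z : Spacetime × ℝ => z.1.fst :=
        (WithLp.fstL 2 ℝ ℝ ℝ).continuous.comp continuous_fst
      have h3 : Continuous (Function.uncurry H) := by
        simp only [H, Function.uncurry_def]
        have := Real.continuous_fourierChar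
        fun_prop
      exact h3.aestronglyMeasurable
    · simp only [H, Function.uncurry, norm_mul, Circle.norm_coe, one_mul]
      rw [mul_comm]
  calc ∫ x, 𝐞 (inner ℝ x (pt τ ξ)) • (SchwartzMap.smulLeftCLM ℂ (timeCutoff η T) (𝓕 φ)) x
      = ∫ x, ∫ ν, H x ν := by
        refine integral_congr_ae (Filter.Eventually.of_forall fun x => ?_)
        simp only [SchwartzMap.smulLeftCLM_apply_apply hη, H, timeCutoff]
        rw [← integral_cutoffHat η hT, Circle.smul_def, smul_eq_mul, smul_eq_mul,
          mul_comm (∫ ν, _), ← integral_const_mul, ← integral_const_mul]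
        congr 1; ext ν; ring
    _ = ∫ ν, ∫ x, H x ν := integral_integral_swap hH
    _ = _ := by
        refine integral_congr_ae (Filter.Eventually.of_forall fun ν => ?_)
        simp only [H]
        rw [hinv (pt (τ + ν) ξ), ← integral_const_mul]
        congr 1; ext x
        have : inner ℝ x (pt (τ + ν) ξ) = inner ℝ x (pt τ ξ) + x.fst * ν := by
          rw [inner_pt, inner_pt]; ring
        rw [this, AddChar.map_add_eq_mul, Circle.coe_mul]
        ring

/-- Convolution in the time frequency. -/
noncomputable def freqConv (k : ℝ → ℂ) (g : ℝ × ℝ → ℂ) (p : ℝ × ℝ) : ℂ :=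
  ∫ ν, k ν * g (p.1 - ν, p.2)

theorem enorm_freqConv_le {A : ℝ≥0} {n : ℕ} {T : ℝ} {k : ℝ → ℂ}
    (hk : ∀ ν, ‖k ν‖ₑ ≤ A * ENNReal.ofReal (kern n T ν)) {g : ℝ × ℝ → ℂ} (hg : Measurable g)
    (p : ℝ × ℝ) : ‖freqConv k g p‖ₑ ≤ A * kernOp n T (fun q => ‖g q‖ₑ) p := by
  calc ‖freqConv k g p‖ₑ ≤ ∫⁻ ν, ‖k ν * g (p.1 - ν, p.2)‖ₑ := enorm_integral_le_lintegral_enorm _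
    _ ≤ ∫⁻ ν, A * (ENNReal.ofReal (kern n T ν) * ‖g (p.1 - ν, p.2)‖ₑ) := by
        refine lintegral_mono fun ν => ?_
        rw [enorm_mul, ← mul_assoc]
        gcongr
        exact hk ν
    _ = A * ∫⁻ ν, ENNReal.ofReal (kern n T ν) * ‖g (p.1 - ν, p.2)‖ₑ :=
        lintegral_const_mul _ (by fun_prop)
    _ = _ := by
        unfold kernOp
        rw [← lintegral_sub_left_eq_self (fun ν => ENNReal.ofReal (kern n T ν) *
          ‖g (p.1 - ν, p.2)‖ₑ) p.1]
        simp

/-- Integrability up to polynomial weights. -/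
def TemperedIntegrable (g : ℝ × ℝ → ℂ) : Prop :=
  ∃ N : ℕ, ∫⁻ p : ℝ × ℝ, ENNReal.ofReal (((1 + ‖p‖) ^ N)⁻¹) * ‖g p‖ₑ < ⊤

theorem norm_le_norm_pt (p : ℝ × ℝ) : ‖p‖ ≤ ‖pt p.1 p.2‖ := by
  have h : ‖pt p.1 p.2‖ = Real.sqrt (‖p.1‖ ^ 2 + ‖p.2‖ ^ 2) := by
    rw [WithLp.prod_norm_eq_of_L2]; rfl
  rw [h, Prod.norm_def]
  refine max_le ?_ ?_ <;> refine Real.le_sqrt_of_sq_le ?_ <;>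
    nlinarith [sq_nonneg ‖p.1‖, sq_nonneg ‖p.2‖]

/-- Absolute convergence for the Fubini argument of `hasFourierDensity_cutoffMul`. Only finiteness
matters, so the bound may blow up as `T → 0`. -/
theorem lintegral_shift_lt_top (η : 𝓢(ℝ, ℂ)) {T : ℝ} (hT : 0 < T) (hT1 : T < 1)
    (φ : 𝓢(Spacetime, ℂ)) {g : ℝ × ℝ → ℂ} (hg : Measurable g) (hgt : TemperedIntegrable g) :
    ∫⁻ ν, ∫⁻ p : ℝ × ℝ, ‖cutoffHat η T ν * φ (pt (p.1 + ν) p.2) * g p‖ₑ < ⊤ := by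
  obtain ⟨N, hN⟩ := hgt
  obtain ⟨C, hC0, hC⟩ := exists_norm_mul_pow_le φ N
  -- `N` powers pay for moving the decay of `φ` from the shifted point back to `p`; the other two
  -- make the `ν` integral converge.
  obtain ⟨A, hA⟩ := exists_norm_cutoffHat_le η (N + 2)
  have hφ : ∀ (p : ℝ × ℝ) (ν : ℝ), ‖φ (pt (p.1 + ν) p.2)‖ ≤
      C * ((1 + |ν|) ^ N * ((1 + ‖p‖) ^ N)⁻¹) := by
    intro p ν
    refine (hC _).trans ?_
    gcongr
    have h1 := norm_le_norm_pt (p.1 + ν, p.2)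
    have h2 : ‖p‖ ≤ ‖((p.1 + ν, p.2) : ℝ × ℝ)‖ + |ν| := by
      calc ‖p‖ = ‖((p.1 + ν, p.2) : ℝ × ℝ) - (ν, 0)‖ := by congr 1; ext <;> simp
        _ ≤ _ := norm_sub_le _ _
        _ = _ := by rw [show ‖((ν, 0) : ℝ × ℝ)‖ = |ν| by simp [Prod.norm_def]]
    have h3 : 1 + ‖p‖ ≤ (1 + ‖pt (p.1 + ν) p.2‖) * (1 + |ν|) := by
      simp only at h1
      nlinarith [abs_nonneg ν, norm_nonneg (pt (p.1 + ν) p.2)]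
    rw [← div_eq_mul_inv, le_div_iff₀ (by positivity), ← div_eq_inv_mul,
      div_le_iff₀ (by positivity), ← mul_pow, mul_comm (1 + |ν|)]
    exact pow_le_pow_left₀ (by positivity) h3 _
  have hk : ∀ ν : ℝ, ‖cutoffHat η T ν‖ₑ * ENNReal.ofReal ((1 + |ν|) ^ N) ≤
      A * ENNReal.ofReal (T * (T ^ (N + 2))⁻¹) * ENNReal.ofReal (((1 + |ν|) ^ 2)⁻¹) := by
    intro ν
    calc _ ≤ A * ENNReal.ofReal (kern (N + 2) T ν) * ENNReal.ofReal ((1 + |ν|) ^ N) := by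
          gcongr; exact hA T hT ν
      _ ≤ _ := by
          rw [mul_assoc, mul_assoc, ← ENNReal.ofReal_mul (kern_nonneg _ hT _),
            ← ENNReal.ofReal_mul (by positivity)]
          gcongr _ * ENNReal.ofReal ?_
          unfold kern
          have h4 : T * (1 + |ν|) ≤ 1 + T * |ν| := by nlinarith
          have h5 : ((1 + T * |ν|) ^ (N + 2))⁻¹ ≤ ((T * (1 + |ν|)) ^ (N + 2))⁻¹ :=
            inv_anti₀ (by positivity) (pow_le_pow_left₀ (by positivity) h4 _)
          calc T * ((1 + T * |ν|) ^ (N + 2))⁻¹ * (1 + |ν|) ^ N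
              ≤ T * ((T * (1 + |ν|)) ^ (N + 2))⁻¹ * (1 + |ν|) ^ N := by gcongr
            _ = _ := by
              have : (0 : ℝ) < 1 + |ν| := by positivity
              rw [mul_pow, pow_add (1 + |ν|)]
              field_simp
  calc ∫⁻ ν, ∫⁻ p : ℝ × ℝ, ‖cutoffHat η T ν * φ (pt (p.1 + ν) p.2) * g p‖ₑ
      ≤ ∫⁻ ν, ∫⁻ p : ℝ × ℝ, (ENNReal.ofReal C * (A * ENNReal.ofReal (T * (T ^ (N + 2))⁻¹)) *
          ENNReal.ofReal (((1 + |ν|) ^ 2)⁻¹)) *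
          (ENNReal.ofReal (((1 + ‖p‖) ^ N)⁻¹) * ‖g p‖ₑ) := by
        refine lintegral_mono fun ν => lintegral_mono fun p => ?_
        rw [enorm_mul, enorm_mul, ← ofReal_norm (φ _)]
        calc _ ≤ ‖cutoffHat η T ν‖ₑ *
              ENNReal.ofReal (C * ((1 + |ν|) ^ N * ((1 + ‖p‖) ^ N)⁻¹)) * ‖g p‖ₑ := by
              gcongr; exact hφ p ν
          _ = ENNReal.ofReal C * (‖cutoffHat η T ν‖ₑ * ENNReal.ofReal ((1 + |ν|) ^ N)) *
              (ENNReal.ofReal (((1 + ‖p‖) ^ N)⁻¹) * ‖g p‖ₑ) := by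
              rw [ENNReal.ofReal_mul hC0, ENNReal.ofReal_mul (by positivity)]; ring
          _ ≤ ENNReal.ofReal C * (A * ENNReal.ofReal (T * (T ^ (N + 2))⁻¹) *
              ENNReal.ofReal (((1 + |ν|) ^ 2)⁻¹)) *
              (ENNReal.ofReal (((1 + ‖p‖) ^ N)⁻¹) * ‖g p‖ₑ) := by gcongr _ * ?_ * _; exact hk ν
          _ = _ := by ring
    _ = (∫⁻ ν : ℝ, (ENNReal.ofReal C * (A * ENNReal.ofReal (T * (T ^ (N + 2))⁻¹)) *
          ENNReal.ofReal (((1 + |ν|) ^ 2)⁻¹))) *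
          ∫⁻ p : ℝ × ℝ, (ENNReal.ofReal (((1 + ‖p‖) ^ N)⁻¹) * ‖g p‖ₑ) := by
        rw [← lintegral_mul_const _ (by fun_prop)]
        refine lintegral_congr fun ν => ?_
        rw [lintegral_const_mul _ (by fun_prop)]
    _ < ⊤ := by
        refine ENNReal.mul_lt_top ?_ hN
        rw [lintegral_const_mul _ (by fun_prop)]
        refine ENNReal.mul_lt_top (ENNReal.mul_lt_top ENNReal.ofReal_lt_top
          (ENNReal.mul_lt_top ENNReal.coe_lt_top ENNReal.ofReal_lt_top)) ?_
        refine lt_of_eq_of_lt (lintegral_congr fun x => ?_)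
          (finite_integral_one_add_norm (E := ℝ) (μ := volume) (r := 2) (by simp))
        rw [Real.rpow_neg (by positivity), Real.rpow_ofNat, Real.norm_eq_abs]

theorem measurable_freqConv {k : ℝ → ℂ} (hk : Measurable k) {g : ℝ × ℝ → ℂ} (hg : Measurable g) :
    StronglyMeasurable (freqConv k g) := by
  have h : Measurable fun z : (ℝ × ℝ) × ℝ => k z.2 * g (z.1.1 - z.2, z.1.2) := by fun_prop
  exact h.stronglyMeasurable.integral_prod_right

/-- The convolution theorem by duality: test against `φ`, move the cutoff onto the test function,
and undo the resulting shift by translation invariance in `τ`. -/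
theorem hasFourierDensity_cutoffMul (η : 𝓢(ℝ, ℂ)) {T : ℝ} (hT : 0 < T) (hT1 : T < 1)
    (hη : (timeCutoff η T).HasTemperateGrowth) {u : 𝓢'(Spacetime, ℂ)} {g : ℝ × ℝ → ℂ}
    (hg : Measurable g) (hgt : TemperedIntegrable g) (hu : HasFourierDensity u g) :
    HasFourierDensity (cutoffMul η T u) (freqConv (cutoffHat η T) g) := by
  refine ⟨(measurable_freqConv (continuous_cutoffHat η T).measurable hg).aestronglyMeasurable,
    fun φ => ?_⟩
  have hφ := φ.continuous.measurable
  let H : ℝ × ℝ → ℝ → ℂ := fun p ν => cutoffHat η T ν * φ (pt (p.1 + ν) p.2) * g p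
  let H' : ℝ × ℝ → ℝ → ℂ := fun p ν => cutoffHat η T ν * φ (pt p.1 p.2) * g (p.1 - ν, p.2)
  have mφ : Measurable fun z : (ℝ × ℝ) × ℝ => φ (pt (z.1.1 + z.2) z.1.2) := by
    have := φ.continuous.comp (continuous_pt.comp
      (show Continuous fun z : (ℝ × ℝ) × ℝ => (z.1.1 + z.2, z.1.2) by fun_prop))
    exact this.measurable
  have mφ' : Measurable fun z : (ℝ × ℝ) × ℝ => φ (pt z.1.1 z.1.2) := by
    have := φ.continuous.comp (continuous_pt.comp
      (show Continuous fun z : (ℝ × ℝ) × ℝ => (z.1.1, z.1.2) by fun_prop))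
    exact this.measurable
  have mk : Measurable (cutoffHat η T) := (continuous_cutoffHat η T).measurable
  have mH : Measurable (Function.uncurry H) := by
    simp only [H, Function.uncurry_def]; fun_prop
  have mH' : Measurable (Function.uncurry H') := by
    simp only [H', Function.uncurry_def]; fun_prop
  have hshift : ∀ ν p, H' p ν = H (p - (ν, 0)) ν := by
    intro ν p
    have : p - (ν, 0) = (p.1 - ν, p.2) := by ext <;> simp
    simp [H, H', this]
  have hfin := lintegral_shift_lt_top η hT hT1 φ hg hgt
  have hH : Integrable (Function.uncurry H) (volume.prod volume) := by
    refine ⟨mH.aestronglyMeasurable, ?_⟩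
    rw [hasFiniteIntegral_iff_enorm, lintegral_prod_symm' _ (by fun_prop)]
    exact hfin
  have hH' : Integrable (Function.uncurry H') (volume.prod volume) := by
    refine ⟨mH'.aestronglyMeasurable, ?_⟩
    rw [hasFiniteIntegral_iff_enorm, lintegral_prod_symm' _ (by fun_prop)]
    refine lt_of_eq_of_lt (lintegral_congr fun ν => ?_) hfin
    simp only [Function.uncurry_apply_pair, hshift]
    exact lintegral_sub_right_eq_self (fun p => ‖H p ν‖ₑ) (ν, 0)
  have hconv : ∀ p, φ (pt p.1 p.2) * freqConv (cutoffHat η T) g p = ∫ ν, H' p ν := by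
    intro p
    simp only [freqConv, H', ← integral_const_mul]
    congr 1; ext ν; ring
  simp only [hconv]
  refine ⟨hH'.integral_prod_left, ?_⟩
  set φ' := 𝓕⁻ (SchwartzMap.smulLeftCLM ℂ (timeCutoff η T) (𝓕 φ)) with hφ'
  have h1 : (𝓕 (cutoffMul η T u)) φ = (𝓕 u) φ' := by
    rw [TemperedDistribution.fourier_apply, TemperedDistribution.fourier_apply, hφ',
      FourierTransform.fourier_fourierInv_eq, cutoffMul,
      TemperedDistribution.smulLeftCLM_apply_apply]
  rw [h1, (hu.2 φ').2]
  calc ∫ p : ℝ × ℝ, φ' (pt p.1 p.2) * g p = ∫ p, ∫ ν, H p ν := by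
        refine integral_congr_ae (Filter.Eventually.of_forall fun p => ?_)
        simp only [hφ', H]
        rw [fourierInv_cutoff_mul_fourier η hT hη, ← integral_mul_const]
    _ = ∫ ν, ∫ p, H p ν := integral_integral_swap hH
    _ = ∫ ν, ∫ p, H' p ν := by
        refine integral_congr_ae (Filter.Eventually.of_forall fun ν => ?_)
        simp only [hshift]
        exact (integral_sub_right_eq_self (fun p => H p ν) (ν, 0)).symm
    _ = _ := (integral_integral_swap hH').symm

/-! ### Fourier densities -/

theorem HasFourierDensity.add {u v : 𝓢'(Spacetime, ℂ)} {g h : ℝ × ℝ → ℂ}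
    (hu : HasFourierDensity u g) (hv : HasFourierDensity v h) :
    HasFourierDensity (u + v) (g + h) := by
  refine ⟨hu.1.add hv.1, fun φ => ?_⟩
  have h1 := hu.2 φ
  have h2 := hv.2 φ
  simp only [Pi.add_apply, mul_add]
  refine ⟨h1.1.add h2.1, ?_⟩
  rw [integral_add h1.1 h2.1, ← h1.2, ← h2.2, FourierTransform.fourier_add]
  rfl

theorem HasFourierDensity.const_smul {u : 𝓢'(Spacetime, ℂ)} {g : ℝ × ℝ → ℂ}
    (hu : HasFourierDensity u g) (c : ℂ) : HasFourierDensity (c • u) (c • g) := by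
  refine ⟨hu.1.const_smul c, fun φ => ?_⟩
  have h1 := hu.2 φ
  simp only [Pi.smul_apply, smul_eq_mul, mul_left_comm _ c]
  refine ⟨h1.1.const_mul c, ?_⟩
  rw [integral_const_mul, ← h1.2, FourierTransform.fourier_smul]
  rfl

theorem HasFourierDensity.congr_ae {u : 𝓢'(Spacetime, ℂ)} {g h : ℝ × ℝ → ℂ}
    (hu : HasFourierDensity u g) (hgh : g =ᵐ[volume] h) : HasFourierDensity u h := by
  refine ⟨hu.1.congr hgh, fun φ => ?_⟩
  have h1 := hu.2 φ
  have h2 : (fun p : ℝ × ℝ => φ (pt p.1 p.2) * g p) =ᵐ[volume]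
      fun p : ℝ × ℝ => φ (pt p.1 p.2) * h p := by
    filter_upwards [hgh] with p hp
    rw [hp]
  exact ⟨h1.1.congr h2, h1.2.trans (integral_congr_ae h2)⟩

/-- A smooth compactly supported real function on `ℝ × ℝ` as a test function on space-time. -/
theorem exists_schwartzMap_pt {χ : ℝ × ℝ → ℝ} (hχ : ContDiff ℝ ∞ χ) (hχ' : HasCompactSupport χ) :
    ∃ φ : 𝓢(Spacetime, ℂ), ∀ p : ℝ × ℝ, φ (pt p.1 p.2) = χ p := by
  have h1 : ContDiff ℝ ∞ (fun p => (χ p : ℂ)) := Complex.ofRealCLM.contDiff.comp hχ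
  have h2 : HasCompactSupport (fun p => (χ p : ℂ)) :=
    hχ'.comp_left (g := fun x : ℝ => (x : ℂ)) Complex.ofReal_zero
  refine ⟨SchwartzMap.compCLMOfContinuousLinearEquiv ℂ (WithLp.prodContinuousLinearEquiv 2 ℝ ℝ ℝ)
    (h2.toSchwartzMap h1), fun p => ?_⟩
  rw [pt_eq]
  simp

theorem locallyIntegrable_of_forall_schwartzMap {g : ℝ × ℝ → ℂ}
    (hg : ∀ φ : 𝓢(Spacetime, ℂ), Integrable fun p : ℝ × ℝ => φ (pt p.1 p.2) * g p) :
    LocallyIntegrable g := by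
  intro x
  -- The bump equals 1 on the unit ball, so there the tested product is `g` itself.
  let χ : ContDiffBump x := ⟨1, 2, one_pos, one_lt_two⟩
  obtain ⟨φ, hφ⟩ := exists_schwartzMap_pt χ.contDiff χ.hasCompactSupport
  refine ⟨Metric.closedBall x 1, Metric.closedBall_mem_nhds x one_pos, ?_⟩
  refine (hg φ).integrableOn.congr_fun (fun p hp => ?_) Metric.isClosed_closedBall.measurableSet
  simp only
  rw [hφ, χ.one_of_mem_closedBall hp]
  simp

/-- The fundamental lemma of the calculus of variations; it turns the distributional equation into a
pointwise identity of densities. -/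
theorem ae_eq_of_forall_schwartzMap {g h : ℝ × ℝ → ℂ}
    (hg : ∀ φ : 𝓢(Spacetime, ℂ), Integrable fun p : ℝ × ℝ => φ (pt p.1 p.2) * g p)
    (hh : ∀ φ : 𝓢(Spacetime, ℂ), Integrable fun p : ℝ × ℝ => φ (pt p.1 p.2) * h p)
    (hgh : ∀ φ : 𝓢(Spacetime, ℂ), ∫ p : ℝ × ℝ, φ (pt p.1 p.2) * g p =
      ∫ p : ℝ × ℝ, φ (pt p.1 p.2) * h p) : g =ᵐ[volume] h := by
  refine ae_eq_of_integral_contDiff_smul_eq (locallyIntegrable_of_forall_schwartzMap hg)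
    (locallyIntegrable_of_forall_schwartzMap hh) fun χ hχ hχ' => ?_
  obtain ⟨φ, hφ⟩ := exists_schwartzMap_pt hχ hχ'
  simpa only [hφ, Complex.real_smul] using hgh φ

/-- The transport equation in terms of Fourier densities. -/
theorem SolvesTransport.density_eq {κ : ℝ} {u G : 𝓢'(Spacetime, ℂ)} {h w : ℝ × ℝ → ℂ}
    (hu : HasFourierDensity u h) (hG : HasFourierDensity G w) (huG : SolvesTransport κ u G) :
    ∀ᵐ p : ℝ × ℝ, 2 * Real.pi * Complex.I * ((p.1 + κ * p.2 : ℝ) : ℂ) * h p = w p := by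
  -- Multiplication of test functions by the symbol `2πi(τ + κξ)` of the transport operator; the
  -- Fourier transform conjugates it to minus the derivative.
  let M : 𝓢(Spacetime, ℂ) → 𝓢(Spacetime, ℂ) := fun φ =>
    (2 * Real.pi * Complex.I) • (SchwartzMap.smulLeftCLM ℂ (inner ℝ · (pt 1 0)) φ +
      κ • SchwartzMap.smulLeftCLM ℂ (inner ℝ · (pt 0 1)) φ)
  have hM : ∀ φ (p : ℝ × ℝ), M φ (pt p.1 p.2) * h p =
      φ (pt p.1 p.2) * (2 * Real.pi * Complex.I * ((p.1 + κ * p.2 : ℝ) : ℂ) * h p) := by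
    intro φ p
    have h1 : (fun x : Spacetime => inner ℝ x (pt 1 0)).HasTemperateGrowth := by fun_prop
    have h2 : (fun x : Spacetime => inner ℝ x (pt 0 1)).HasTemperateGrowth := by fun_prop
    simp only [M, smul_apply, add_apply,
      SchwartzMap.smulLeftCLM_apply_apply h1, SchwartzMap.smulLeftCLM_apply_apply h2]
    have h3 : (pt p.1 p.2).fst = p.1 := rfl
    have h4 : (pt p.1 p.2).snd = p.2 := rfl
    simp only [inner_pt, h3, h4, Complex.real_smul, smul_eq_mul]
    push_cast
    ring
  refine ae_eq_of_forall_schwartzMap (fun φ => ?_) (fun φ => (hG.2 φ).1) fun φ => ?_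
  · simpa only [hM] using (hu.2 (M φ)).1
  · rw [← (hG.2 φ).2, ← integral_congr_ae (Filter.Eventually.of_forall (hM φ)), ← (hu.2 (M φ)).2,
      ← huG]
    have h3 : 𝓕 (M φ) = -∂_{pt 1 0} (𝓕 φ) + (κ : ℂ) • -∂_{pt 0 1} (𝓕 φ) := by
      rw [SchwartzMap.lineDerivOp_fourier_eq, SchwartzMap.lineDerivOp_fourier_eq]
      simp only [M, FourierTransform.fourier_smul, FourierTransform.fourier_add]
      simp only [smul_add, neg_smul, neg_neg]
      rw [smul_comm]
      rfl
    rw [TemperedDistribution.fourier_apply, h3, map_add, map_smul]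
    rfl

/-! ### Products with cutoffs -/

theorem timeCutoff_mul (η ζ : ℝ → ℂ) (T : ℝ) :
    timeCutoff η T * timeCutoff ζ T = timeCutoff (η * ζ) T := rfl

theorem cutoffMul_cutoffMul {η ζ : ℝ → ℂ} {T : ℝ} (hη : (timeCutoff η T).HasTemperateGrowth)
    (hζ : (timeCutoff ζ T).HasTemperateGrowth) (h : ζ * η = η) (u : 𝓢'(Spacetime, ℂ)) :
    cutoffMul η T (cutoffMul ζ T u) = cutoffMul η T u := by
  unfold cutoffMul
  rw [TemperedDistribution.smulLeftCLM_smulLeftCLM_apply hζ hη, timeCutoff_mul, h]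

/-- Leibniz rule: only `∂_t` falls on the cutoff, and it produces `T⁻¹ η'(t/T)`. -/
theorem SolvesTransport.cutoffMul {κ : ℝ} {ψ F : 𝓢'(Spacetime, ℂ)} (h : SolvesTransport κ ψ F)
    {η : ℝ → ℂ} (hη : ContDiff ℝ ∞ η) (hη' : HasCompactSupport η) (T : ℝ) :
    SolvesTransport κ (NullEnergy.cutoffMul η T ψ)
      ((T⁻¹ : ℂ) • NullEnergy.cutoffMul (deriv η) T ψ + NullEnergy.cutoffMul η T F) := by
  have g1 := timeCutoff_hasTemperateGrowth hη hη' T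
  have g2 := timeCutoff_hasTemperateGrowth
    (show ContDiff ℝ ∞ (deriv η) from hη.deriv') hη'.deriv T
  have key : ∀ (v : Spacetime) (φ : 𝓢(Spacetime, ℂ)),
      ∂_{v} (SchwartzMap.smulLeftCLM ℂ (timeCutoff η T) φ) =
        SchwartzMap.smulLeftCLM ℂ (timeCutoff η T) (∂_{v} φ) +
        ((v.fst / T : ℝ) : ℂ) • SchwartzMap.smulLeftCLM ℂ (timeCutoff (deriv η) T) φ := by
    intro v φ
    ext x
    rw [SchwartzMap.lineDerivOp_apply_eq_fderiv, SchwartzMap.smulLeftCLM_apply g1]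
    have e1 : HasDerivAt η (deriv η (x.fst / T))
        ((T⁻¹ • WithLp.fstL 2 ℝ ℝ ℝ : Spacetime →L[ℝ] ℝ) x) := by
      have : (T⁻¹ • WithLp.fstL 2 ℝ ℝ ℝ : Spacetime →L[ℝ] ℝ) x = x.fst / T := by
        simp [div_eq_inv_mul]
      rw [this]
      exact (hη.differentiable (by simp) _).hasDerivAt
    have e2 := e1.hasFDerivAt.comp x
      (T⁻¹ • WithLp.fstL 2 ℝ ℝ ℝ : Spacetime →L[ℝ] ℝ).hasFDerivAt
    have e3 : timeCutoff η T = η ∘ (T⁻¹ • WithLp.fstL 2 ℝ ℝ ℝ : Spacetime →L[ℝ] ℝ) := by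
      ext p
      simp [timeCutoff, div_eq_inv_mul]
    rw [← e3] at e2
    have e4 : fderiv ℝ (fun y => timeCutoff η T y • φ y) x = _ :=
      (e2.mul (φ.hasFDerivAt x)).fderiv
    rw [e4]
    simp only [add_apply, smul_apply, SchwartzMap.smulLeftCLM_apply_apply g1,
      SchwartzMap.smulLeftCLM_apply_apply g2, SchwartzMap.lineDerivOp_apply_eq_fderiv]
    simp [timeCutoff, div_eq_inv_mul]
    ring
  unfold SolvesTransport
  ext φ
  -- The equation tested against `η(t/T) φ`; the product rule `key` then separates the two source
  -- terms.
  have hF : F (SchwartzMap.smulLeftCLM ℂ (timeCutoff η T) φ) =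
      ψ (-∂_{pt 1 0} (SchwartzMap.smulLeftCLM ℂ (timeCutoff η T) φ)) +
      κ • ψ (-∂_{pt 0 1} (SchwartzMap.smulLeftCLM ℂ (timeCutoff η T) φ)) := by
    rw [← h]; rfl
  rw [key, key] at hF
  change ψ (SchwartzMap.smulLeftCLM ℂ (timeCutoff η T) (-∂_{pt 1 0} φ)) +
    κ • ψ (SchwartzMap.smulLeftCLM ℂ (timeCutoff η T) (-∂_{pt 0 1} φ)) =
    (T⁻¹ : ℂ) • ψ (SchwartzMap.smulLeftCLM ℂ (timeCutoff (deriv η) T) φ) +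
      F (SchwartzMap.smulLeftCLM ℂ (timeCutoff η T) φ)
  rw [hF]
  simp only [pt, map_neg, map_add, map_smul, smul_eq_mul, Complex.real_smul]
  simp
  ring

/-! ### Finite norms give tempered densities; conclusion -/

theorem ennreal_mul_le_sq_add_sq (a b : ℝ≥0∞) : a * b ≤ a ^ 2 + b ^ 2 := by
  rcases le_total a b with h | h
  · calc a * b ≤ b * b := by gcongr
      _ = b ^ 2 := (sq b).symm
      _ ≤ _ := le_add_self
  · calc a * b ≤ a * a := by gcongr
      _ = a ^ 2 := (sq a).symm
      _ ≤ _ := le_self_add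

theorem inv_le_rpow_of_le {x y s : ℝ} (hx : 1 ≤ x) (hxy : x ≤ y) (hs : -1 ≤ s) :
    y⁻¹ ≤ x ^ s := by
  calc y⁻¹ ≤ x⁻¹ := inv_anti₀ (by linarith) hxy
    _ = x ^ (-1 : ℝ) := (Real.rpow_neg_one x).symm
    _ ≤ _ := Real.rpow_le_rpow_of_exponent_le hx hs

/-- One power of `1 + |ξ|` absorbs the weight since `s ≥ -1`; the other is square integrable in `ξ`
and pairs with the `L²_ξ` norm. -/
theorem temperedIntegrable_of_L2L1 {s : ℝ} (hs : -1 ≤ s) {g : ℝ × ℝ → ℂ} (hg : Measurable g)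
    (h : ∫⁻ ξ, (∫⁻ τ, ENNReal.ofReal (bracket ξ ^ s) * ‖g (τ, ξ)‖ₑ) ^ 2 < ⊤) :
    TemperedIntegrable g := by
  refine ⟨2, ?_⟩
  rw [Measure.volume_eq_prod, lintegral_prod_symm' _ (by fun_prop)]
  calc ∫⁻ ξ : ℝ, ∫⁻ τ : ℝ, ENNReal.ofReal (((1 + ‖((τ, ξ) : ℝ × ℝ)‖) ^ 2)⁻¹) * ‖g (τ, ξ)‖ₑ
      ≤ ∫⁻ ξ : ℝ, ENNReal.ofReal ((1 + |ξ|)⁻¹) *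
          ∫⁻ τ, ENNReal.ofReal (bracket ξ ^ s) * ‖g (τ, ξ)‖ₑ := by
        refine lintegral_mono fun ξ => ?_
        rw [← lintegral_const_mul _ (by fun_prop)]
        refine lintegral_mono fun τ => ?_
        rw [← mul_assoc, ← ENNReal.ofReal_mul (by positivity)]
        gcongr ENNReal.ofReal ?_ * _
        have h1 : |ξ| ≤ ‖((τ, ξ) : ℝ × ℝ)‖ := norm_snd_le (τ, ξ)
        have h2 := inv_le_rpow_of_le (one_le_bracket ξ) (bracket_le ξ) hs
        calc ((1 + ‖((τ, ξ) : ℝ × ℝ)‖) ^ 2)⁻¹ ≤ ((1 + |ξ|) ^ 2)⁻¹ := by gcongr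
          _ = (1 + |ξ|)⁻¹ * (1 + |ξ|)⁻¹ := by rw [sq, mul_inv]
          _ ≤ _ := by gcongr
    _ ≤ ∫⁻ ξ : ℝ, (ENNReal.ofReal ((1 + |ξ|)⁻¹) ^ 2 +
          (∫⁻ τ, ENNReal.ofReal (bracket ξ ^ s) * ‖g (τ, ξ)‖ₑ) ^ 2) :=
        lintegral_mono fun ξ => ennreal_mul_le_sq_add_sq _ _
    _ = (∫⁻ ξ : ℝ, ENNReal.ofReal ((1 + |ξ|)⁻¹) ^ 2) +
          ∫⁻ ξ, (∫⁻ τ, ENNReal.ofReal (bracket ξ ^ s) * ‖g (τ, ξ)‖ₑ) ^ 2 :=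
        lintegral_add_left (by fun_prop) _
    _ < ⊤ := by
        refine ENNReal.add_lt_top.2 ⟨?_, h⟩
        refine lt_of_eq_of_lt (lintegral_congr fun x => ?_)
          (finite_integral_one_add_norm (E := ℝ) (μ := volume) (r := 2) (by simp))
        rw [Real.rpow_neg (by positivity), Real.rpow_ofNat, Real.norm_eq_abs,
          ← ENNReal.ofReal_pow (by positivity), inv_pow]

/-- Each bracket weight costs one power of `1 + ‖p‖`; the two remaining powers are square integrable
on the plane. -/
theorem temperedIntegrable_of_weighted_L2 {κ s a : ℝ} (hκ : κ = 1 ∨ κ = -1) (hs : -1 ≤ s)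
    (ha : -1 ≤ a) {f : ℝ × ℝ → ℂ}
    (h : ∫⁻ p : ℝ × ℝ, (ENNReal.ofReal (bracket (p.1 - κ * p.2) ^ s *
      bracket (p.1 + κ * p.2) ^ a) * ‖f p‖ₑ) ^ 2 < ⊤) : TemperedIntegrable f := by
  refine ⟨4, ?_⟩
  have hpt : ∀ p : ℝ × ℝ, ((1 + ‖p‖) ^ 4)⁻¹ ≤ 4 * ((1 + ‖p‖) ^ 2)⁻¹ *
      (bracket (p.1 - κ * p.2) ^ s * bracket (p.1 + κ * p.2) ^ a) := by
    intro p
    have h1 : |p.1| ≤ ‖p‖ := norm_fst_le p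
    have h2 : |κ * p.2| ≤ ‖p‖ := by
      have : |p.2| ≤ ‖p‖ := norm_snd_le p
      rcases hκ with h | h <;> simpa [h] using this
    have h3 : bracket (p.1 - κ * p.2) ≤ 2 * (1 + ‖p‖) := by
      have := abs_sub p.1 (κ * p.2)
      linarith [bracket_le (p.1 - κ * p.2), norm_nonneg p]
    have h4 : bracket (p.1 + κ * p.2) ≤ 2 * (1 + ‖p‖) := by
      have := abs_add_le p.1 (κ * p.2)
      linarith [bracket_le (p.1 + κ * p.2), norm_nonneg p]
    have h5 := inv_le_rpow_of_le (one_le_bracket _) h3 hs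
    have h6 := inv_le_rpow_of_le (one_le_bracket _) h4 ha
    have h7 : (0 : ℝ) < 1 + ‖p‖ := by positivity
    calc ((1 + ‖p‖) ^ 4)⁻¹ = 4 * ((1 + ‖p‖) ^ 2)⁻¹ *
          ((2 * (1 + ‖p‖))⁻¹ * (2 * (1 + ‖p‖))⁻¹) := by field_simp; norm_num
      _ ≤ _ := by
        have := Real.rpow_nonneg (bracket_pos (p.1 - κ * p.2)).le s
        gcongr
  calc ∫⁻ p : ℝ × ℝ, ENNReal.ofReal (((1 + ‖p‖) ^ 4)⁻¹) * ‖f p‖ₑ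
      ≤ ∫⁻ p : ℝ × ℝ, ENNReal.ofReal (4 * ((1 + ‖p‖) ^ 2)⁻¹) *
          (ENNReal.ofReal (bracket (p.1 - κ * p.2) ^ s *
            bracket (p.1 + κ * p.2) ^ a) * ‖f p‖ₑ) := by
        refine lintegral_mono fun p => ?_
        rw [← mul_assoc, ← ENNReal.ofReal_mul (by positivity)]
        gcongr ENNReal.ofReal ?_ * _
        exact hpt p
    _ ≤ ∫⁻ p : ℝ × ℝ, (ENNReal.ofReal (4 * ((1 + ‖p‖) ^ 2)⁻¹) ^ 2 +
          (ENNReal.ofReal (bracket (p.1 - κ * p.2) ^ s *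
            bracket (p.1 + κ * p.2) ^ a) * ‖f p‖ₑ) ^ 2) :=
        lintegral_mono fun p => ennreal_mul_le_sq_add_sq _ _
    _ = (∫⁻ p : ℝ × ℝ, ENNReal.ofReal (4 * ((1 + ‖p‖) ^ 2)⁻¹) ^ 2) + _ :=
        lintegral_add_left (by fun_prop) _
    _ < ⊤ := by
        refine ENNReal.add_lt_top.2 ⟨?_, h⟩
        have e : ∀ p : ℝ × ℝ, ENNReal.ofReal (4 * ((1 + ‖p‖) ^ 2)⁻¹) ^ 2 =
            16 * ENNReal.ofReal ((1 + ‖p‖) ^ (-(4 : ℝ))) := by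
          intro p
          rw [Real.rpow_neg (by positivity), Real.rpow_ofNat, ← ENNReal.ofReal_pow (by positivity),
            show (16 : ℝ≥0∞) = ENNReal.ofReal 16 by simp, ← ENNReal.ofReal_mul (by norm_num)]
          congr 1
          rw [mul_pow, inv_pow, ← pow_mul]
          norm_num
        simp_rw [e]
        rw [lintegral_const_mul _ (by fun_prop)]
        refine ENNReal.mul_lt_top (by simp) ?_
        exact finite_integral_one_add_norm (by simp; norm_num)

/-- The energy estimate for given Fourier densities. -/
theorem exists_zNorm_cutoffMul_le {s ε b : ℝ} (hs : -1 / 2 < s) (hs' : s ≤ 0) (hε : 0 < ε)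
    (hb : 1 / 2 < b) (hbs : b < 1 + s) (hbε : b < 1 - ε)
    {ρ σ : ℝ → ℂ} (hρ : ContDiff ℝ ∞ ρ) (hρc : HasCompactSupport ρ)
    (hσ : ContDiff ℝ ∞ σ) (hσc : HasCompactSupport σ) (hσ1 : ∀ t ∈ tsupport ρ, σ t = 1)
    {κ : ℝ} (hκ : κ = 1 ∨ κ = -1) :
    ∃ C : ℝ≥0, 1 ≤ C ∧ ∀ T : ℝ, 0 < T → T < 1 →
      ∀ ψ F : 𝓢'(Spacetime, ℂ), SolvesTransport κ ψ F → ∀ g f : ℝ × ℝ → ℂ,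
        HasFourierDensity (cutoffMul σ T ψ) g → HasFourierDensity F f →
        ZNorm κ s b (cutoffMul ρ T ψ) ≤
          C * (ENNReal.ofReal (T ^ (1 / 2 - b)) *
            (∫⁻ ξ, (∫⁻ τ, ENNReal.ofReal (bracket ξ ^ s) * ‖g (τ, ξ)‖ₑ) ^ (2 : ℝ)) ^ (1 / 2 : ℝ) +
            ENNReal.ofReal (T ^ ε) * (∫⁻ p : ℝ × ℝ,
              (ENNReal.ofReal (bracket (p.1 - κ * p.2) ^ s *
                bracket (p.1 + κ * p.2) ^ (b - 1 + ε)) * ‖f p‖ₑ) ^ (2 : ℝ)) ^ (1 / 2 : ℝ)) := by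
  have hρ' : ContDiff ℝ ∞ (deriv ρ) := hρ.deriv'
  let R : 𝓢(ℝ, ℂ) := hρc.toSchwartzMap hρ
  let R' : 𝓢(ℝ, ℂ) := hρc.deriv.toSchwartzMap hρ'
  obtain ⟨A₁, hA₁⟩ := exists_norm_cutoffHat_le R 4
  obtain ⟨A₂, hA₂⟩ := exists_norm_cutoffHat_le R' 4
  obtain ⟨C, hC1, hC⟩ := exists_weighted_norm_le hs hs' hε hb hbs hbε (A₁ + A₂)
  refine ⟨C, hC1, fun T hT hT1 ψ F hψ g₀ f₀ hg₀ hf₀ => ?_⟩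
  have hC0 : (C : ℝ≥0∞) ≠ 0 := by
    have : C ≠ 0 := (zero_lt_one.trans_le hC1).ne'
    exact_mod_cast this
  set f : ℝ × ℝ → ℂ := hf₀.1.mk f₀
  set g : ℝ × ℝ → ℂ := hg₀.1.mk g₀
  have hfm : Measurable f := hf₀.1.stronglyMeasurable_mk.measurable
  have hgm : Measurable g := hg₀.1.stronglyMeasurable_mk.measurable
  have hff : f₀ =ᵐ[volume] f := hf₀.1.ae_eq_mk
  have hgg : g₀ =ᵐ[volume] g := hg₀.1.ae_eq_mk
  have hf := hf₀.congr_ae hff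
  have hg := hg₀.congr_ae hgg
  have hfn : ∫⁻ p : ℝ × ℝ, (ENNReal.ofReal (bracket (p.1 - κ * p.2) ^ s *
      bracket (p.1 + κ * p.2) ^ (b - 1 + ε)) * ‖f₀ p‖ₑ) ^ (2 : ℝ) =
      ∫⁻ p : ℝ × ℝ, (ENNReal.ofReal (bracket (p.1 - κ * p.2) ^ s *
      bracket (p.1 + κ * p.2) ^ (b - 1 + ε)) * ‖f p‖ₑ) ^ (2 : ℝ) := by
    refine lintegral_congr_ae ?_
    filter_upwards [hff] with p hp
    rw [hp]
  have hgn : ∫⁻ ξ, (∫⁻ τ, ENNReal.ofReal (bracket ξ ^ s) * ‖g₀ (τ, ξ)‖ₑ) ^ (2 : ℝ) =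
      ∫⁻ ξ, (∫⁻ τ, ENNReal.ofReal (bracket ξ ^ s) * ‖g (τ, ξ)‖ₑ) ^ (2 : ℝ) := by
    have h1 : ∀ᵐ z : ℝ × ℝ ∂(volume.prod volume), g₀ z.swap = g z.swap :=
      Measure.measurePreserving_swap.quasiMeasurePreserving.ae hgg
    refine lintegral_congr_ae ?_
    filter_upwards [Measure.ae_ae_of_ae_prod h1] with ξ hξ
    congr 1
    refine lintegral_congr_ae ?_
    filter_upwards [hξ] with τ hτ
    simp only [Prod.swap_prod_mk] at hτ
    rw [hτ]
  rw [hfn, hgn]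
  have hTb : ENNReal.ofReal (T ^ (1 / 2 - b)) ≠ 0 := by
    simpa using Real.rpow_pos_of_pos hT _
  have hTe : ENNReal.ofReal (T ^ ε) ≠ 0 := by
    simpa using Real.rpow_pos_of_pos hT _
  -- The convolution theorem needs tempered densities, known only for finite norms. An infinite norm
  -- makes the right side infinite, as the powers of `T` and `C` are nonzero.
  by_cases hgt : ∫⁻ ξ, (∫⁻ τ, ENNReal.ofReal (bracket ξ ^ s) * ‖g (τ, ξ)‖ₑ) ^ (2 : ℝ) = ⊤
  · rw [hgt, ENNReal.top_rpow_of_pos (by norm_num), ENNReal.mul_top hTb, top_add,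
      ENNReal.mul_top hC0]
    exact le_top
  by_cases hft : ∫⁻ p : ℝ × ℝ, (ENNReal.ofReal (bracket (p.1 - κ * p.2) ^ s *
      bracket (p.1 + κ * p.2) ^ (b - 1 + ε)) * ‖f p‖ₑ) ^ (2 : ℝ) = ⊤
  · rw [hft, ENNReal.top_rpow_of_pos (by norm_num), ENNReal.mul_top hTe, add_top,
      ENNReal.mul_top hC0]
    exact le_top
  have hgT : TemperedIntegrable g := temperedIntegrable_of_L2L1 (s := s) (by linarith) hgm (by
    simpa only [ENNReal.rpow_two] using lt_top_iff_ne_top.2 hgt)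
  have hfT : TemperedIntegrable f := temperedIntegrable_of_weighted_L2 (κ := κ) (s := s)
    (a := b - 1 + ε) hκ (by linarith) (by linarith) (by
    simpa only [ENNReal.rpow_two] using lt_top_iff_ne_top.2 hft)
  have tρ := timeCutoff_hasTemperateGrowth hρ hρc T
  have tρ' := timeCutoff_hasTemperateGrowth hρ' hρc.deriv T
  have tσ := timeCutoff_hasTemperateGrowth hσ hσc T
  have hσρ : σ * ρ = ρ := by
    ext t
    by_cases ht : t ∈ tsupport ρ
    · simp [hσ1 t ht]
    · simp [image_eq_zero_of_notMem_tsupport ht]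
  -- The source term with `ρ'` is also localized where `σ = 1`, so it too is controlled by `g`.
  have hσρ' : σ * deriv ρ = deriv ρ := by
    ext t
    by_cases ht : t ∈ tsupport ρ
    · simp [hσ1 t ht]
    · have : deriv ρ t = 0 := by
        by_contra h0
        exact ht (support_deriv_subset h0)
      simp [this]
  have hh : HasFourierDensity (cutoffMul ρ T ψ) (freqConv (cutoffHat R T) g) := by
    have := hasFourierDensity_cutoffMul R hT hT1 tρ hgm hgT hg
    rwa [← cutoffMul_cutoffMul tρ tσ hσρ ψ]
  have h1 : HasFourierDensity (cutoffMul (deriv ρ) T ψ) (freqConv (cutoffHat R' T) g) := by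
    have := hasFourierDensity_cutoffMul R' hT hT1 tρ' hgm hgT hg
    rwa [← cutoffMul_cutoffMul tρ' tσ hσρ' ψ]
  have h2 : HasFourierDensity (cutoffMul ρ T F) (freqConv (cutoffHat R T) f) :=
    hasFourierDensity_cutoffMul R hT hT1 tρ hfm hfT hf
  have heq := (hψ.cutoffMul hρ hρc T).density_eq hh ((h1.const_smul (T⁻¹ : ℂ)).add h2)
  refine (iInf₂_le _ hh).trans ?_
  have hle₁ : ∀ ν, ‖cutoffHat R T ν‖ₑ ≤ (A₁ + A₂ : ℝ≥0) * ENNReal.ofReal (kern 4 T ν) := by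
    intro ν
    refine (hA₁ T hT ν).trans ?_
    gcongr
    exact le_self_add
  have hle₂ : ∀ ν, ‖cutoffHat R' T ν‖ₑ ≤ (A₁ + A₂ : ℝ≥0) * ENNReal.ofReal (kern 4 T ν) := by
    intro ν
    refine (hA₂ T hT ν).trans ?_
    gcongr
    exact le_add_self
  refine hC κ T hκ hT hT1 (fun p => ‖freqConv (cutoffHat R T) g p‖ₑ) (fun p => ‖g p‖ₑ)
    (fun p => ‖f p‖ₑ) (by fun_prop) (by fun_prop)
    (Filter.Eventually.of_forall fun p => enorm_freqConv_le hle₁ hgm p) ?_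
  filter_upwards [heq] with p hp
  have hT' : ‖(T⁻¹ : ℂ)‖ₑ = ENNReal.ofReal T⁻¹ := by
    rw [← ofReal_norm, norm_inv, Complex.norm_real, Real.norm_eq_abs, abs_of_pos hT]
  calc ENNReal.ofReal |p.1 + κ * p.2| * ‖freqConv (cutoffHat R T) g p‖ₑ
      ≤ ‖2 * Real.pi * Complex.I * ((p.1 + κ * p.2 : ℝ) : ℂ) *
          freqConv (cutoffHat R T) g p‖ₑ := by
        rw [enorm_mul]
        gcongr
        rw [← ofReal_norm]
        -- The factor `2π` of this Fourier normalization is at least 1 and may be dropped.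
        refine ENNReal.ofReal_le_ofReal ?_
        simp only [norm_mul, Complex.norm_real, Complex.norm_I, Real.norm_eq_abs, mul_one,
          Complex.norm_ofNat, abs_of_pos Real.pi_pos]
        nlinarith [Real.pi_gt_three, abs_nonneg (p.1 + κ * p.2)]
    _ = ‖(T⁻¹ : ℂ) * freqConv (cutoffHat R' T) g p + freqConv (cutoffHat R T) f p‖ₑ := by
        rw [hp]; rfl
    _ ≤ ‖(T⁻¹ : ℂ)‖ₑ * ‖freqConv (cutoffHat R' T) g p‖ₑ + ‖freqConv (cutoffHat R T) f p‖ₑ := by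
        rw [← enorm_mul]; exact enorm_add_le _ _
    _ ≤ ENNReal.ofReal T⁻¹ * ((A₁ + A₂ : ℝ≥0) * kernOp 4 T (fun q => ‖g q‖ₑ) p) +
          (A₁ + A₂ : ℝ≥0) * kernOp 4 T (fun q => ‖f q‖ₑ) p := by
        rw [hT']
        gcongr
        · exact enorm_freqConv_le hle₂ hgm p
        · exact enorm_freqConv_le hle₁ hfm p
    _ = _ := by ring

end NullEnergy

theorem proposition4p3 (s ε b : ℝ) (hs : -1 / 2 < s) (hs' : s ≤ 0) (hε : 0 < ε) (hε' : ε < 1 / 2)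
    (hb : 1 / 2 < b) (hb' : b < min (1 + s) (1 - ε))
    (ρ σ : ℝ → ℂ) (hρ : ContDiff ℝ ∞ ρ) (hρc : HasCompactSupport ρ)
    (hσ : ContDiff ℝ ∞ σ) (hσc : HasCompactSupport σ)
    (hρ1 : ∀ t ∈ Set.Icc (-1 : ℝ) 1, ρ t = 1) (hσ1 : ∀ t ∈ tsupport ρ, σ t = 1)
    (hρσ : tsupport ρ ⊆ tsupport σ) (hσ2 : tsupport σ ⊆ Set.Icc (-2 : ℝ) 2)
    (κ : ℝ) (hκ : κ = 1 ∨ κ = -1) :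
    ∃ C : ℝ≥0, ∀ T : ℝ, 0 < T → T < 1 →
      ∀ ψ F : 𝓢'(NullEnergy.Spacetime, ℂ), NullEnergy.SolvesTransport κ ψ F →
        NullEnergy.ZNorm κ s b (NullEnergy.cutoffMul ρ T ψ) ≤
          C * (ENNReal.ofReal (T ^ (1 / 2 - b)) *
                NullEnergy.YNorm κ s 0 (NullEnergy.cutoffMul σ T ψ) +
              ENNReal.ofReal (T ^ ε) * NullEnergy.ZNorm κ s (b - 1 + ε) F) := by
  obtain ⟨C, hC1, hC⟩ := NullEnergy.exists_zNorm_cutoffMul_le hs hs' hε hb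
    (hb'.trans_le (min_le_left _ _)) (hb'.trans_le (min_le_right _ _)) hρ hρc hσ hσc hσ1 hκ
  refine ⟨C, fun T hT hT1 ψ F hψ => ?_⟩
  have hC0 : (C : ℝ≥0∞) ≠ 0 := by
    have : C ≠ 0 := (zero_lt_one.trans_le hC1).ne'
    exact_mod_cast this
  have hTb : ENNReal.ofReal (T ^ (1 / 2 - b)) ≠ 0 := by
    simpa using Real.rpow_pos_of_pos hT _
  have hTe : ENNReal.ofReal (T ^ ε) ≠ 0 := by
    simpa using Real.rpow_pos_of_pos hT _
  have key := hC T hT hT1 ψ F hψ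
  -- The left side is kept opaque so that only the norms on the right are opened as infima. These
  -- come out past the nonzero finite factors, which reduces the claim to arbitrary densities;
  -- without a density the infimum is `∞`.
  generalize NullEnergy.ZNorm κ s b (NullEnergy.cutoffMul ρ T ψ) = L at key ⊢
  unfold NullEnergy.YNorm NullEnergy.ZNorm
  simp only [ENNReal.mul_iInf_of_ne hTb ENNReal.ofReal_ne_top,
    ENNReal.mul_iInf_of_ne hTe ENNReal.ofReal_ne_top, ENNReal.iInf_add, ENNReal.add_iInf,
    ENNReal.mul_iInf_of_ne hC0 ENNReal.coe_ne_top, Real.rpow_zero, mul_one]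
  exact le_iInf₂ fun f hf => le_iInf₂ fun g hg => key g f hg hf
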